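/- For $n\ge 1$ let $p=p_n$ satisfy $0<p\le p_0<1$ for a constant $p_0$, and assume $np/\log n\to\infty$ as $n\to\infty$. On a common probability space let, for each $n$, $A=A_n$ be the adjacency matrix of an Erdős–Rényi random graph $G(n,p)$ (each of the $\binom n2$ edges is present independently with probability $p$, no loops); no assumption is made on the joint law for different $n$. Let $D$ be the diagonal degree matrix, $D_{ii}=\sum_{j}A_{ij}$, put $\alpha=(n-1)p-1$, and define the $2n\times 2n$ matrices $$H=\begin{pmatrix}A & I-D\\ I & 0\end{pmatrix},\qquad H_0=\begin{pmatrix}A & I-\mathbb E(D)\\ I & 0\end{pmatrix}=\begin{pmatrix}A & -\alpha I\\ I & 0\end{pmatrix}.$$ For an $m\times m$ complex matrix $M$ with eigenvalues $\lambda_1,\dots,\lambda_m$ (with algebraic multiplicity) let $\mu_M=\frac1m\sum_{i=1}^m\delta_{\lambda_i}$. Then $\mu_{\frac1{\sqrt\alpha}H}-\mu_{\frac1{\sqrt\alpha}H_0}$ converges weakly to zero almost surely as $n\to\infty$; that is, for every bounded continuous $f:\mathbb C\to\mathbb R$, almost surely $$\Big|\int f\,d\mu_{\frac1{\sqrt\alpha}H}-\int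 f\,d\mu_{\frac1{\sqrt\alpha}H_0}\Big|\to 0 .$$ Consequently the convergence also holds in probability: for every such $f$ and every $\varepsilon>0$, the probability that this absolute difference exceeds $\varepsilon$ tends to $0$. (For the finitely many $n$ with $\alpha\le 0$ the matrices may be rescaled arbitrarily.) -/

import Mathlib

open MeasureTheory ProbabilityTheory Filter Topology BoundedContinuousFunction

noncomputable section

namespace NonBacktracking

open Classical in
/-- The adjacency matrix of a simple graph on `{0, …, n-1}`, with complex entries. -/
def adj {n : ℕ} (G : SimpleGraph (Fin n)) : Matrix (Fin n) (Fin n) ℂ :=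
  G.adjMatrix ℂ

/-- The diagonal degree matrix, `D i i = ∑ j, A i j`. -/
def degMatrix {n : ℕ} (G : SimpleGraph (Fin n)) : Matrix (Fin n) (Fin n) ℂ :=
  Matrix.diagonal fun i => ∑ j, adj G i j

/-- The entrywise expectation of the degree matrix of a `G(n, p)` random graph. -/
def expDegMatrix (n : ℕ) (p : unitInterval) : Matrix (Fin n) (Fin n) ℂ :=
  Matrix.of fun i j => ∫ G, degMatrix G i j ∂(SimpleGraph.binomialRandom (Fin n) p)

/-- The non-backtracking spectrum operator `H = [[A, I - D], [I, 0]]`. -/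
def opH {n : ℕ} (G : SimpleGraph (Fin n)) : Matrix (Fin n ⊕ Fin n) (Fin n ⊕ Fin n) ℂ :=
  Matrix.fromBlocks (adj G) (1 - degMatrix G) 1 0

/-- The partly averaged matrix `H₀ = [[A, I - 𝔼 D], [I, 0]]`. -/
def opH₀ {n : ℕ} (p : unitInterval) (G : SimpleGraph (Fin n)) :
    Matrix (Fin n ⊕ Fin n) (Fin n ⊕ Fin n) ℂ :=
  Matrix.fromBlocks (adj G) (1 - expDegMatrix n p) 1 0

/-- `α = (n - 1) p - 1`, a real number. -/
def alpha (n : ℕ) (p : unitInterval) : ℝ := ((n : ℝ) - 1) * (p : ℝ) - 1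

/-- The matrix `M / √α`. -/
def rescale {n : ℕ} (p : unitInterval) (M : Matrix (Fin n ⊕ Fin n) (Fin n ⊕ Fin n) ℂ) :
    Matrix (Fin n ⊕ Fin n) (Fin n ⊕ Fin n) ℂ :=
  (((1 / √(alpha n p) : ℝ)) : ℂ) • M

/-- The empirical spectral measure of a complex square matrix: the average of the Dirac masses at
its eigenvalues, counted with algebraic multiplicity. -/
def esm {ι : Type*} [Fintype ι] [DecidableEq ι] (M : Matrix ι ι ℂ) : Measure ℂ :=
  (Fintype.card ι : ENNReal)⁻¹ • (M.charpoly.roots.map Measure.dirac).sum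

/-- `μ n - ν n` converges weakly to zero almost surely. -/
def DiffTendstoZeroAS {Ω : Type*} [MeasurableSpace Ω] (P : Measure Ω)
    (μ ν : ℕ → Ω → Measure ℂ) : Prop :=
  ∀ f : ℂ →ᵇ ℝ, ∀ᵐ ω ∂P,
    Tendsto (fun n => |∫ z, f z ∂(μ n ω) - ∫ z, f z ∂(ν n ω)|) atTop (𝓝 0)

/-- `μ n - ν n` converges weakly to zero in probability. -/
def DiffTendstoZeroInProb {Ω : Type*} [MeasurableSpace Ω] (P : Measure Ω)
    (μ ν : ℕ → Ω → Measure ℂ) : Prop :=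
  ∀ f : ℂ →ᵇ ℝ, ∀ ε : ℝ, 0 < ε →
    Tendsto (fun n => P {ω | ε < |∫ z, f z ∂(μ n ω) - ∫ z, f z ∂(ν n ω)|}) atTop (𝓝 0)

end NonBacktracking

end

/-! After division by √α and balancing of the off-diagonal blocks, H and H₀ have the characteristic
polynomials of `companion A d` and `companion A 0`, where A is the scaled adjacency matrix and d i =
(deg i - (n-1)p)/α. A Chernoff bound and np ≫ log n make max |d i| small outside an event of
probability O(n⁻²).

These matrices are not normal, so a small perturbation need not move the spectrum only a little.
What helps is that A is Hermitian: eliminating one block from z - `companion A 0` leaves A - (z +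
1/z), so the resolvent is bounded uniformly in n as long as z stays away from ℝ, the unit circle and
infinity (`boundedBelow_companion`). There the resolvent identity makes the normalized Cauchy
transforms of the two spectra close (`exists_forall_cauchySum_companion_le`). The excluded set has
small area and 1/|z - a| is integrable in the plane uniformly in a, so Cauchy–Pompeiu turns this
into closeness of averages of smooth compactly supported functions
(`exists_forall_norm_sum_sub_sum_le`).

Bounded continuous functions need tightness as well. For `companion A 0` it comes from the trace of
A² (`sum_roots_companion_zero_le`), and it passes to `companion A d` by testing against a cutoff.
Borel–Cantelli concludes. -/

namespace NonBacktracking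

/-! ### The Cauchy–Pompeiu formula -/

/-- The Wirtinger derivative `∂g/∂z̄`. -/
noncomputable def dbar (g : ℂ → ℂ) (z : ℂ) : ℂ :=
  (fderiv ℝ g z 1 + Complex.I * fderiv ℝ g z Complex.I) / 2

/-- The point `cos θ + i sin θ` of the unit circle. -/
noncomputable def circlePt (θ : ℝ) : ℂ := Real.cos θ + Real.sin θ * Complex.I

lemma continuous_circlePt : Continuous circlePt := by
  unfold circlePt; fun_prop

lemma norm_circlePt (θ : ℝ) : ‖circlePt θ‖ = 1 := by
  simp [circlePt]

lemma hasDerivAt_circlePt (θ : ℝ) : HasDerivAt circlePt (Complex.I * circlePt θ) θ := by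
  have h1 : HasDerivAt (fun t : ℝ => ((Real.cos t : ℝ) : ℂ)) ((-Real.sin θ : ℝ) : ℂ) θ :=
    (Real.hasDerivAt_cos θ).ofReal_comp
  have h2 : HasDerivAt (fun t : ℝ => ((Real.sin t : ℝ) : ℂ)) ((Real.cos θ : ℝ) : ℂ) θ :=
    (Real.hasDerivAt_sin θ).ofReal_comp
  have := h1.add (h2.mul_const Complex.I)
  refine this.congr_deriv ?_
  simp only [circlePt]
  push_cast
  linear_combination (-(Complex.sin θ)) * Complex.I_mul_I

/-- The Wirtinger derivative in the orthonormal frame rotated by θ; at a point of argument θ this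
separates the radial from the angular derivative. -/
lemma dbar_eq_polar (g : ℂ → ℂ) (z : ℂ) (θ : ℝ) :
    dbar g z = circlePt θ * (fderiv ℝ g z (circlePt θ)
      + Complex.I * fderiv ℝ g z (Complex.I * circlePt θ)) / 2 := by
  have h1 : circlePt θ = Real.cos θ • (1 : ℂ) + Real.sin θ • Complex.I := by
    simp [circlePt]
  have h2 : Complex.I * circlePt θ = (-Real.sin θ) • (1 : ℂ) + Real.cos θ • Complex.I := by
    simp only [circlePt, Complex.real_smul]
    push_cast
    linear_combination (Complex.sin θ) * Complex.I_mul_I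
  have e1 : fderiv ℝ g z (circlePt θ) =
      Complex.cos θ * fderiv ℝ g z 1 + Complex.sin θ * fderiv ℝ g z Complex.I := by
    rw [h1, map_add, map_smul, map_smul]
    simp
  have e2 : fderiv ℝ g z (Complex.I * circlePt θ) =
      -Complex.sin θ * fderiv ℝ g z 1 + Complex.cos θ * fderiv ℝ g z Complex.I := by
    rw [h2, map_add, map_smul, map_smul]
    simp
  rw [e1, e2]
  simp only [dbar, circlePt]
  push_cast
  have h3 := Complex.sin_sq_add_cos_sq (θ : ℂ)
  set a := fderiv ℝ g z 1
  set b := fderiv ℝ g z Complex.I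
  have hI := Complex.I_mul_I
  linear_combination (-(1/2 : ℂ)) * (a + Complex.I * b) * h3 -
    (1/2 : ℂ) * (-a * Complex.sin θ ^ 2 + b * Complex.cos θ * Complex.sin θ) * hI

section CauchyPompeiu

variable {g : ℂ → ℂ}

lemma continuous_radial_fderiv (hg : ContDiff ℝ 1 g) {w : ℝ → ℂ} (hw : Continuous w) :
    Continuous fun p : ℝ × ℝ => fderiv ℝ g (p.1 * circlePt p.2) (w p.2) := by
  have h := (hg.continuous_fderiv one_ne_zero)
  have h1 : Continuous fun p : ℝ × ℝ => fderiv ℝ g ((p.1 : ℂ) * circlePt p.2) :=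
    h.comp (by have := continuous_circlePt; fun_prop)
  exact h1.clm_apply (hw.comp continuous_snd)

lemma integrableOn_radial_fderiv (hg : ContDiff ℝ 1 g) (hc : HasCompactSupport g)
    {w : ℝ → ℂ} (hw : Continuous w) :
    IntegrableOn (fun p : ℝ × ℝ => fderiv ℝ g (p.1 * circlePt p.2) (w p.2))
      (Set.Ioi (0 : ℝ) ×ˢ Set.Ioo (-Real.pi) Real.pi) := by
  obtain ⟨R, hR⟩ := (hc.fderiv (𝕜 := ℝ)).isCompact.isBounded.subset_closedBall (0 : ℂ)
  have h1 : IntegrableOn (fun p : ℝ × ℝ => fderiv ℝ g (p.1 * circlePt p.2) (w p.2))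
      (Set.Icc (0 : ℝ) R ×ˢ Set.Icc (-Real.pi) Real.pi) :=
    (continuous_radial_fderiv hg hw).continuousOn.integrableOn_compact
      (isCompact_Icc.prod isCompact_Icc)
  refine h1.of_forall_sdiff_eq_zero (measurableSet_Ioi.prod measurableSet_Ioo) ?_
  rintro ⟨r, θ⟩ ⟨⟨h2, h3⟩, h4⟩
  have h5 : ¬ r ≤ R := fun h => h4 ⟨⟨le_of_lt h2, h⟩, ⟨h3.1.le, h3.2.le⟩⟩
  have h6 : (r : ℂ) * circlePt θ ∉ tsupport (fderiv ℝ g) := by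
    intro h
    have := hR h
    simp only [mem_closedBall_zero_iff, norm_mul, norm_circlePt, mul_one, Complex.norm_real,
      Real.norm_eq_abs, abs_of_pos (show (0 : ℝ) < r from h2)] at this
    exact h5 this
  simp [image_eq_zero_of_notMem_tsupport h6]

lemma integral_radial (hg : ContDiff ℝ 1 g) (hc : HasCompactSupport g) (θ : ℝ) :
    ∫ r in Set.Ioi (0 : ℝ), fderiv ℝ g ((r : ℂ) * circlePt θ) (circlePt θ) = - g 0 := by
  have hd : ∀ r : ℝ, HasDerivAt (fun r : ℝ => g ((r : ℂ) * circlePt θ))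
      (fderiv ℝ g ((r : ℂ) * circlePt θ) (circlePt θ)) r := by
    intro r
    have h1 := (hg.differentiable one_ne_zero ((r : ℂ) * circlePt θ)).hasFDerivAt
    have h2 : HasDerivAt (fun r : ℝ => (r : ℂ) * circlePt θ) (circlePt θ) r := by
      simpa using (Complex.ofRealCLM.hasDerivAt (x := r)).mul_const (circlePt θ)
    exact h1.comp_hasDerivAt r h2
  obtain ⟨R, hR⟩ := hc.isCompact.isBounded.subset_closedBall (0 : ℂ)
  have hz : ∀ r : ℝ, r ∉ Set.Icc (-R) R → g ((r : ℂ) * circlePt θ) = 0 := by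
    intro r hr
    apply image_eq_zero_of_notMem_tsupport
    intro h
    have := hR h
    simp only [mem_closedBall_zero_iff, norm_mul, norm_circlePt, mul_one, Complex.norm_real,
      Real.norm_eq_abs] at this
    exact hr (abs_le.1 this)
  have hcs : HasCompactSupport (fun r : ℝ => g ((r : ℂ) * circlePt θ)) :=
    HasCompactSupport.intro isCompact_Icc hz
  have hcd : ContDiff ℝ 1 (fun r : ℝ => g ((r : ℂ) * circlePt θ)) :=
    hg.comp ((Complex.ofRealCLM.contDiff).mul contDiff_const)
  have := hcs.integral_Ioi_deriv_eq hcd 0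
  simp only [fun r => (hd r).deriv] at this
  simpa using this

/-- The integrand has the 2π-periodic primitive r⁻¹ g(r e^{iθ}). -/
lemma integral_angular (hg : ContDiff ℝ 1 g) {r : ℝ} (hr : 0 < r) :
    ∫ θ in Set.Ioo (-Real.pi) Real.pi,
      fderiv ℝ g ((r : ℂ) * circlePt θ) (Complex.I * circlePt θ) = 0 := by
  have hd : ∀ θ : ℝ, HasDerivAt (fun θ : ℝ => (r : ℂ)⁻¹ * g ((r : ℂ) * circlePt θ))
      (fderiv ℝ g ((r : ℂ) * circlePt θ) (Complex.I * circlePt θ)) θ := by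
    intro θ
    have h1 := (hg.differentiable one_ne_zero ((r : ℂ) * circlePt θ)).hasFDerivAt
    have h2 := (hasDerivAt_circlePt θ).const_mul (r : ℂ)
    have h3 := (h1.comp_hasDerivAt θ h2).const_mul (r : ℂ)⁻¹
    refine h3.congr_deriv ?_
    rw [show (r : ℂ) * (Complex.I * circlePt θ) = r • (Complex.I * circlePt θ) by simp, map_smul,
      Complex.real_smul, inv_mul_cancel_left₀ (by exact_mod_cast hr.ne')]
  have hcont : Continuous fun θ : ℝ => fderiv ℝ g ((r : ℂ) * circlePt θ)
      (Complex.I * circlePt θ) :=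
    (continuous_radial_fderiv hg (w := fun θ => Complex.I * circlePt θ)
      (continuous_const.mul continuous_circlePt)).comp (by fun_prop : Continuous fun θ => (r, θ))
  rw [← integral_Ioc_eq_integral_Ioo, ← intervalIntegral.integral_of_le (by linarith [Real.pi_pos]),
    intervalIntegral.integral_eq_sub_of_hasDerivAt (fun θ _ => hd θ) (hcont.intervalIntegrable _ _)]
  simp [circlePt]

/-- The polar Jacobian r cancels the singularity 1/z. The angular derivative integrates to zero over
each circle, and the radial one gives -g(0) on each ray. -/
lemma integral_dbar_div (hg : ContDiff ℝ 1 g) (hc : HasCompactSupport g) :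
    ∫ z, dbar g z / z = - (Real.pi : ℂ) * g 0 := by
  have hi1 := integrableOn_radial_fderiv hg hc continuous_circlePt
  have hi2 := integrableOn_radial_fderiv hg hc (w := fun θ => Complex.I * circlePt θ)
      (continuous_const.mul continuous_circlePt)
  rw [← Complex.integral_comp_polarCoord_symm]
  have e1 : ∫ p in polarCoord.target, p.1 • (dbar g (Complex.polarCoord.symm p) /
        Complex.polarCoord.symm p) =
      ∫ p in Set.Ioi (0 : ℝ) ×ˢ Set.Ioo (-Real.pi) Real.pi,
        ((1 / 2 : ℂ) * fderiv ℝ g (p.1 * circlePt p.2) (circlePt p.2) +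
          (Complex.I / 2) * fderiv ℝ g (p.1 * circlePt p.2) (Complex.I * circlePt p.2)) := by
    refine setIntegral_congr_fun (measurableSet_Ioi.prod measurableSet_Ioo) ?_
    rintro ⟨r, θ⟩ ⟨hr, -⟩
    have hr' : (r : ℂ) ≠ 0 := by exact_mod_cast (ne_of_gt hr : r ≠ 0)
    have hc : circlePt θ ≠ 0 := by
      rw [← norm_ne_zero_iff, norm_circlePt]; exact one_ne_zero
    have hs : Complex.polarCoord.symm (r, θ) = r * circlePt θ := by
      simp [circlePt]
    simp only [hs, Complex.real_smul]
    rw [dbar_eq_polar g _ θ]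
    field_simp
  rw [e1, integral_add (hi1.const_mul _) (hi2.const_mul _), integral_const_mul, integral_const_mul]
  have e2 : ∫ p in Set.Ioi (0 : ℝ) ×ˢ Set.Ioo (-Real.pi) Real.pi,
      fderiv ℝ g (p.1 * circlePt p.2) (Complex.I * circlePt p.2) = 0 := by
    rw [Measure.volume_eq_prod] at hi2 ⊢
    rw [setIntegral_prod _ hi2, setIntegral_congr_fun measurableSet_Ioi
      (fun r hr => integral_angular hg hr)]
    simp
  have e3 : ∫ p in Set.Ioi (0 : ℝ) ×ˢ Set.Ioo (-Real.pi) Real.pi,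
      fderiv ℝ g (p.1 * circlePt p.2) (circlePt p.2) = - (2 * Real.pi) * g 0 := by
    rw [Measure.volume_eq_prod] at hi1 ⊢
    rw [← setIntegral_prod_swap]
    refine (setIntegral_prod _ hi1.swap).trans ?_
    simp only [Function.comp, Prod.fst_swap, Prod.snd_swap]
    simp only [integral_radial hg hc]
    simp only [integral_const, measureReal_restrict_apply_univ, Real.volume_real_Ioo,
      Complex.real_smul]
    rw [max_eq_left (by linarith [Real.pi_pos])]
    push_cast
    ring
  rw [e2, e3]
  ring

/-- The **Cauchy–Pompeiu formula** for compactly supported functions. -/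
theorem integral_dbar_div_sub (hg : ContDiff ℝ 1 g) (hc : HasCompactSupport g) (a : ℂ) :
    ∫ z, dbar g z / (z - a) = - (Real.pi : ℂ) * g a := by
  have h1 : ContDiff ℝ 1 (fun z => g (z + a)) := hg.comp (contDiff_id.add contDiff_const)
  have h2 : HasCompactSupport (fun z => g (z + a)) :=
    hc.comp_homeomorph (Homeomorph.addRight a)
  have h3 := integral_dbar_div h1 h2
  rw [← integral_add_right_eq_self _ a]
  simp only [zero_add] at h3
  rw [← h3]
  congr 1
  ext z
  simp only [dbar, fderiv_comp_add_right, add_sub_cancel_right]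

lemma continuous_dbar (hg : ContDiff ℝ 1 g) : Continuous (dbar g) := by
  have h := hg.continuous_fderiv one_ne_zero
  unfold dbar
  exact ((h.clm_apply continuous_const).add
    (continuous_const.mul (h.clm_apply continuous_const))).div_const _

lemma hasCompactSupport_dbar (hc : HasCompactSupport g) : HasCompactSupport (dbar g) := by
  refine (hc.fderiv (𝕜 := ℝ)).mono ?_
  intro z hz h
  apply hz
  simp [dbar, h]

end CauchyPompeiu

/-! ### The Cauchy kernel on sets of finite area -/

lemma lintegral_ball_inv_norm {r : ℝ} (hr : 0 ≤ r) :
    ∫⁻ z in Metric.ball (0 : ℂ) r, ENNReal.ofReal ‖z‖⁻¹ ≤ ENNReal.ofReal (2 * Real.pi * r) := by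
  rw [← lintegral_indicator Metric.isOpen_ball.measurableSet,
    ← Complex.lintegral_comp_polarCoord_symm]
  calc _ ≤ ∫⁻ p in Set.Ioi (0 : ℝ) ×ˢ Set.Ioo (-Real.pi) Real.pi,
        (Set.Ioo 0 r ×ˢ Set.Ioo (-Real.pi) Real.pi).indicator (fun _ => 1) p := by
        refine setLIntegral_mono' (measurableSet_Ioi.prod measurableSet_Ioo) ?_
        rintro ⟨s, θ⟩ ⟨hs, hθ⟩
        have hs' : 0 < s := hs
        have hn : ‖Complex.polarCoord.symm (s, θ)‖ = s := by
          rw [Complex.norm_polarCoord_symm, abs_of_pos hs']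
        by_cases h : s < r
        · rw [Set.indicator_of_mem (by rw [mem_ball_zero_iff, hn]; exact h),
            Set.indicator_of_mem (show (s, θ) ∈ Set.Ioo 0 r ×ˢ Set.Ioo (-Real.pi) Real.pi from
              ⟨⟨hs', h⟩, hθ⟩), hn, smul_eq_mul,
            ← ENNReal.ofReal_mul hs'.le, mul_inv_cancel₀ hs'.ne']
          simp
        · rw [Set.indicator_of_notMem (by rw [mem_ball_zero_iff, hn]; exact h)]
          simp
    _ ≤ ∫⁻ p : ℝ × ℝ, (Set.Ioo 0 r ×ˢ Set.Ioo (-Real.pi) Real.pi).indicator (fun _ => 1) p :=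
        setLIntegral_le_lintegral _ _
    _ = ENNReal.ofReal (2 * Real.pi * r) := by
        rw [lintegral_indicator (measurableSet_Ioo.prod measurableSet_Ioo)]
        simp only [lintegral_const, one_mul, Measure.restrict_apply_univ]
        rw [Measure.volume_eq_prod, Measure.prod_prod, Real.volume_Ioo, Real.volume_Ioo,
          ← ENNReal.ofReal_mul (by linarith)]
        congr 1
        ring

/-- Split at distance r from the pole. The bound does not depend on a, so no knowledge of where
eigenvalues lie is needed later. -/
lemma setLIntegral_inv_norm_sub_le (S : Set ℂ) (a : ℂ) {r : ℝ} (hr : 0 < r) :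
    ∫⁻ z in S, ENNReal.ofReal ‖z - a‖⁻¹ ≤
      volume S * ENNReal.ofReal r⁻¹ + ENNReal.ofReal (2 * Real.pi * r) := by
  have hpt : ∀ z : ℂ, ENNReal.ofReal ‖z - a‖⁻¹ ≤ ENNReal.ofReal r⁻¹ +
      (Metric.ball (0 : ℂ) r).indicator (fun z => ENNReal.ofReal ‖z‖⁻¹) (z - a) := by
    intro z
    by_cases h : ‖z - a‖ < r
    · rw [Set.indicator_of_mem (by rwa [mem_ball_zero_iff])]
      exact le_add_self
    · rw [Set.indicator_of_notMem (by rwa [mem_ball_zero_iff]), add_zero]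
      exact ENNReal.ofReal_le_ofReal (inv_anti₀ hr (not_lt.1 h))
  calc _ ≤ ∫⁻ z in S, (ENNReal.ofReal r⁻¹ +
      (Metric.ball (0 : ℂ) r).indicator (fun z => ENNReal.ofReal ‖z‖⁻¹) (z - a)) :=
        lintegral_mono hpt
    _ = ENNReal.ofReal r⁻¹ * volume S + ∫⁻ z in S,
        (Metric.ball (0 : ℂ) r).indicator (fun z => ENNReal.ofReal ‖z‖⁻¹) (z - a) := by
        rw [lintegral_add_left measurable_const]; simp
    _ ≤ ENNReal.ofReal r⁻¹ * volume S + ∫⁻ z,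
        (Metric.ball (0 : ℂ) r).indicator (fun z => ENNReal.ofReal ‖z‖⁻¹) (z - a) := by
        gcongr; exact Measure.restrict_le_self
    _ ≤ _ := by
        rw [mul_comm]
        gcongr
        rw [lintegral_sub_right_eq_self
          (fun z => (Metric.ball (0 : ℂ) r).indicator (fun z => ENNReal.ofReal ‖z‖⁻¹) z) a,
          lintegral_indicator Metric.isOpen_ball.measurableSet]
        exact lintegral_ball_inv_norm hr.le

lemma integrableOn_inv_norm_sub {S : Set ℂ} (hS : volume S ≠ ⊤) (a : ℂ) :
    IntegrableOn (fun z => ‖z - a‖⁻¹) S := by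
  refine ⟨by fun_prop, ?_⟩
  rw [hasFiniteIntegral_iff_ofReal (ae_of_all _ fun z => by positivity)]
  refine (setLIntegral_inv_norm_sub_le S a one_pos).trans_lt ?_
  exact ENNReal.add_lt_top.2 ⟨ENNReal.mul_lt_top hS.lt_top ENNReal.ofReal_lt_top,
    ENNReal.ofReal_lt_top⟩

lemma setIntegral_inv_norm_sub_le {S : Set ℂ} (hS : volume S ≠ ⊤) (a : ℂ) {r : ℝ} (hr : 0 < r) :
    ∫ z in S, ‖z - a‖⁻¹ ≤ volume.real S * r⁻¹ + 2 * Real.pi * r := by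
  have h := setLIntegral_inv_norm_sub_le S a hr
  rw [integral_eq_lintegral_of_nonneg_ae (ae_of_all _ fun z => by positivity)
    (integrableOn_inv_norm_sub hS a).1]
  refine (ENNReal.toReal_mono ?_ h).trans ?_
  · exact (ENNReal.add_lt_top.2 ⟨ENNReal.mul_lt_top hS.lt_top ENNReal.ofReal_lt_top,
      ENNReal.ofReal_lt_top⟩).ne
  · rw [ENNReal.toReal_add (ENNReal.mul_lt_top hS.lt_top ENNReal.ofReal_lt_top).ne
      ENNReal.ofReal_lt_top.ne, ENNReal.toReal_mul, ENNReal.toReal_ofReal (by positivity),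
      ENNReal.toReal_ofReal (by positivity), Measure.real]

/-! ### Comparing sums over two multisets through their Cauchy transforms -/

/-- The Cauchy transform `∑ 1 / (z - a)` of a multiset of complex numbers. -/
noncomputable def cauchySum (S : Multiset ℂ) (z : ℂ) : ℂ := (S.map fun a => 1 / (z - a)).sum

lemma cauchySum_cons (a : ℂ) (S : Multiset ℂ) (z : ℂ) :
    cauchySum (a ::ₘ S) z = 1 / (z - a) + cauchySum S z := by
  simp [cauchySum]

lemma integrableOn_cauchySum {B : Set ℂ} (hB : volume B ≠ ⊤) (S : Multiset ℂ) :
    IntegrableOn (cauchySum S) B := by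
  induction S using Multiset.induction with
  | empty => simp [show cauchySum 0 = fun _ => 0 from funext fun z => by simp [cauchySum]]
  | cons a S ih =>
    have h1 : IntegrableOn (fun z => 1 / (z - a)) B := by
      refine Integrable.mono' (integrableOn_inv_norm_sub hB a)
        (by measurability) (ae_of_all _ ?_)
      intro z
      simp
    exact (h1.add ih).congr (ae_of_all _ fun z => (cauchySum_cons a S z).symm)

lemma setIntegral_norm_cauchySum_le {B : Set ℂ} (hB : volume B ≠ ⊤) (S : Multiset ℂ) {r : ℝ}
    (hr : 0 < r) :
    ∫ z in B, ‖cauchySum S z‖ ≤ S.card * (volume.real B * r⁻¹ + 2 * Real.pi * r) := by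
  induction S using Multiset.induction with
  | empty => simp [cauchySum]
  | cons a S ih =>
    calc ∫ z in B, ‖cauchySum (a ::ₘ S) z‖ ≤ ∫ z in B, (‖z - a‖⁻¹ + ‖cauchySum S z‖) := by
          refine integral_mono (integrableOn_cauchySum hB _).norm
            ((integrableOn_inv_norm_sub hB a).add (integrableOn_cauchySum hB S).norm) ?_
          intro z
          simp only [cauchySum_cons]
          refine (norm_add_le _ _).trans ?_
          simp
      _ = (∫ z in B, ‖z - a‖⁻¹) + ∫ z in B, ‖cauchySum S z‖ :=
          integral_add (integrableOn_inv_norm_sub hB a) (integrableOn_cauchySum hB S).norm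
      _ ≤ _ := by
          have := setIntegral_inv_norm_sub_le hB a hr
          rw [Multiset.card_cons]
          push_cast
          linarith

section

variable {g : ℂ → ℂ}

lemma integrable_dbar_mul_cauchySum (hg : ContDiff ℝ 1 g) (hc : HasCompactSupport g)
    (S : Multiset ℂ) : Integrable fun z => dbar g z * cauchySum S z := by
  have hK := (hasCompactSupport_dbar hc).isCompact
  obtain ⟨M, hM⟩ := (hasCompactSupport_dbar hc).exists_bound_of_continuous (continuous_dbar hg)
  have h1 : IntegrableOn (fun z => dbar g z * cauchySum S z) (tsupport (dbar g)) :=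
    Integrable.bdd_mul (integrableOn_cauchySum hK.measure_lt_top.ne S)
      (continuous_dbar hg).aestronglyMeasurable (ae_of_all _ hM)
  refine (integrableOn_iff_integrable_of_support_subset ?_).1 h1
  intro z hz
  refine subset_tsupport _ ?_
  intro h
  exact hz (by simp [h])

lemma integral_dbar_mul_cauchySum (hg : ContDiff ℝ 1 g) (hc : HasCompactSupport g)
    (S : Multiset ℂ) :
    ∫ z, dbar g z * cauchySum S z = - (Real.pi : ℂ) * (S.map g).sum := by
  induction S using Multiset.induction with
  | empty => simp [cauchySum]
  | cons a S ih =>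
    have h0 : Integrable fun z => dbar g z * (1 / (z - a)) := by
      have := integrable_dbar_mul_cauchySum hg hc {a}
      simpa [cauchySum] using this
    simp only [cauchySum_cons, mul_add]
    rw [integral_add h0 (integrable_dbar_mul_cauchySum hg hc S), ih]
    have := integral_dbar_div_sub hg hc a
    simp only [mul_one_div, this, Multiset.map_cons, Multiset.sum_cons]
    ring

/-- If the Cauchy transforms of two multisets of the same size are close off a set of small area,
then so are the sums of a smooth test function. -/
lemma norm_sum_sub_sum_le (hg : ContDiff ℝ 1 g) (hc : HasCompactSupport g) {M R r κ : ℝ}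
    (hM : ∀ z, ‖dbar g z‖ ≤ M) (hR : tsupport (dbar g) ⊆ Metric.closedBall 0 R)
    {B : Set ℂ} (hB : MeasurableSet B) (hBR : B ⊆ Metric.closedBall 0 R) (hr : 0 < r)
    {S T : Multiset ℂ} (hST : S.card = T.card)
    (h : ∀ z ∈ Metric.closedBall 0 R \ B, ‖cauchySum S z - cauchySum T z‖ ≤ κ * S.card) :
    Real.pi * ‖(S.map g).sum - (T.map g).sum‖ ≤
      M * (S.card * (κ * volume.real (Metric.closedBall (0 : ℂ) R \ B) +
        2 * (volume.real B * r⁻¹ + 2 * Real.pi * r))) := by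
  have hbt : volume (Metric.closedBall (0 : ℂ) R) ≠ ⊤ :=
    (isCompact_closedBall _ _).measure_lt_top.ne
  have hBt : volume B ≠ ⊤ := measure_ne_top_of_subset hBR hbt
  have hCt : volume (Metric.closedBall (0 : ℂ) R \ B) ≠ ⊤ :=
    measure_ne_top_of_subset Set.sdiff_subset hbt
  set Δ : ℂ → ℂ := fun z => cauchySum S z - cauchySum T z with hΔ
  have hΔi : ∀ {C : Set ℂ}, volume C ≠ ⊤ → IntegrableOn Δ C := fun hC =>
    (integrableOn_cauchySum hC S).sub (integrableOn_cauchySum hC T)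
  have e1 : ∫ z, dbar g z * Δ z = - (Real.pi : ℂ) * ((S.map g).sum - (T.map g).sum) := by
    simp only [hΔ, mul_sub]
    rw [integral_sub (integrable_dbar_mul_cauchySum hg hc S)
      (integrable_dbar_mul_cauchySum hg hc T), integral_dbar_mul_cauchySum hg hc,
      integral_dbar_mul_cauchySum hg hc]
  have e2 : Real.pi * ‖(S.map g).sum - (T.map g).sum‖ = ‖∫ z, dbar g z * Δ z‖ := by
    rw [e1, norm_mul, norm_neg, Complex.norm_real, Real.norm_of_nonneg Real.pi_pos.le]
  have e3 : ∫ z, dbar g z * Δ z = ∫ z in Metric.closedBall 0 R, dbar g z * Δ z := by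
    refine (setIntegral_eq_integral_of_forall_compl_eq_zero fun z hz => ?_).symm
    rw [image_eq_zero_of_notMem_tsupport fun hz' => hz (hR hz'), zero_mul]
  have hM0 : 0 ≤ M := (norm_nonneg _).trans (hM 0)
  rw [e2, e3]
  calc ‖∫ z in Metric.closedBall 0 R, dbar g z * Δ z‖
      ≤ ∫ z in Metric.closedBall 0 R, M * ‖Δ z‖ := by
        refine norm_integral_le_of_norm_le ((hΔi hbt).norm.const_mul M) (ae_of_all _ fun z => ?_)
        rw [norm_mul]
        exact mul_le_mul_of_nonneg_right (hM z) (norm_nonneg _)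
    _ = M * ((∫ z in Metric.closedBall 0 R \ B, ‖Δ z‖) + ∫ z in B, ‖Δ z‖) := by
        rw [integral_const_mul, ← setIntegral_union Set.disjoint_sdiff_left hB
          (hΔi hCt).norm (hΔi hBt).norm, Set.sdiff_union_of_subset hBR]
    _ ≤ _ := by
        refine mul_le_mul_of_nonneg_left ?_ hM0
        have h1 : ∫ z in Metric.closedBall 0 R \ B, ‖Δ z‖ ≤
            κ * S.card * volume.real (Metric.closedBall (0 : ℂ) R \ B) := by
          have := norm_setIntegral_le_of_norm_le_const (μ := volume) (f := fun z => ‖Δ z‖)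
            (C := κ * S.card) hCt.lt_top (fun z hz => by simpa using h z hz)
          exact (le_abs_self _).trans this
        -- No cancellation is available on `B`: the two transforms are bounded separately, using
        -- only the small area.
        have h2 : ∫ z in B, ‖Δ z‖ ≤ S.card * (volume.real B * r⁻¹ + 2 * Real.pi * r) +
            T.card * (volume.real B * r⁻¹ + 2 * Real.pi * r) := by
          refine le_trans ?_ (add_le_add (setIntegral_norm_cauchySum_le hBt S hr)
            (setIntegral_norm_cauchySum_le hBt T hr))
          rw [← integral_add (integrableOn_cauchySum hBt S).norm
            (integrableOn_cauchySum hBt T).norm]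
          exact integral_mono (hΔi hBt).norm ((integrableOn_cauchySum hBt S).norm.add
            (integrableOn_cauchySum hBt T).norm) fun z => norm_sub_le _ _
        rw [← hST] at h2
        linarith

end

/-! ### Neighbourhoods of the union of the real line and the unit circle -/

/-- A neighbourhood of `ℝ ∪ {|z| = 1}` within the closed disc of radius `R`. -/
def nearCross (R η : ℝ) : Set ℂ :=
  {z | ‖z‖ ≤ R ∧ |z.im| * |‖z‖ ^ 2 - 1| ≤ η}

lemma measurableSet_nearCross (R η : ℝ) : MeasurableSet (nearCross R η) := by
  refine (IsClosed.inter (s₁ := {z : ℂ | ‖z‖ ≤ R})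
    (s₂ := {z : ℂ | |z.im| * |‖z‖ ^ 2 - 1| ≤ η}) ?_ ?_).measurableSet <;>
  exact isClosed_le (by fun_prop) (by fun_prop)

lemma nearCross_subset (R η : ℝ) : nearCross R η ⊆ Metric.closedBall 0 R := fun z hz => by
  simpa using hz.1

lemma volume_im_eq_zero : volume {z : ℂ | z.im = 0} = 0 := by
  have : {z : ℂ | z.im = 0} = (LinearMap.ker Complex.imLm : Set ℂ) := by
    ext z; simp
  rw [this]
  apply Measure.addHaar_submodule
  intro h
  have : Complex.I ∈ LinearMap.ker Complex.imLm := h ▸ Submodule.mem_top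
  simp at this

/-- Continuity from above: the sets decrease to a subset of the real line and the unit circle, which
is null. -/
lemma tendsto_volume_nearCross (R : ℝ) :
    Tendsto (fun k : ℕ => volume.real (nearCross R (1 / ((k : ℝ) + 1)))) atTop (𝓝 0) := by
  have hanti : Antitone fun k : ℕ => nearCross R (1 / ((k : ℝ) + 1)) := by
    intro k l hkl z hz
    exact ⟨hz.1, hz.2.trans (Nat.one_div_le_one_div hkl)⟩
  have h := tendsto_measure_iInter_atTop (μ := volume)
    (fun k : ℕ => (measurableSet_nearCross R (1 / ((k : ℝ) + 1))).nullMeasurableSet) hanti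
    ⟨0, measure_ne_top_of_subset (nearCross_subset _ _)
      (isCompact_closedBall (0 : ℂ) R).measure_lt_top.ne⟩
  have h0 : volume (⋂ k : ℕ, nearCross R (1 / ((k : ℝ) + 1))) = 0 := by
    refine measure_mono_null (t := {z : ℂ | z.im = 0} ∪ Metric.sphere 0 1) ?_
      (measure_union_null volume_im_eq_zero (Measure.addHaar_sphere _ _ _))
    intro z hz
    rw [Set.mem_iInter] at hz
    have h1 : |z.im| * |‖z‖ ^ 2 - 1| ≤ 0 := by
      exact ge_of_tendsto' tendsto_one_div_add_atTop_nhds_zero_nat fun k => (hz k).2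
    rcases mul_eq_zero.1 (le_antisymm h1 (by positivity)) with h2 | h2
    · exact Or.inl (abs_eq_zero.1 h2)
    · right
      have h3 : ‖z‖ ^ 2 = 1 := by linarith [abs_eq_zero.1 h2]
      simpa using (pow_eq_one_iff_of_nonneg (norm_nonneg z) two_ne_zero).1 h3
  rw [h0] at h
  simpa [Measure.real, Function.comp_def] using (ENNReal.tendsto_toReal ENNReal.zero_ne_top).comp h

/-- If the Cauchy transforms of two multisets are close off a small neighbourhood of
`ℝ ∪ {|z| = 1}`, then the averages of a smooth compactly supported function are close. -/
lemma exists_forall_norm_sum_sub_sum_le {g : ℂ → ℂ} (hg : ContDiff ℝ 1 g)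
    (hc : HasCompactSupport g) {ε : ℝ} (hε : 0 < ε) :
    ∃ R > 0, ∃ η > 0, ∃ κ > 0, ∀ S T : Multiset ℂ, S.card = T.card →
      (∀ z, ‖z‖ ≤ R → z ∉ nearCross R η → ‖cauchySum S z - cauchySum T z‖ ≤ κ * S.card) →
      ‖(S.map g).sum - (T.map g).sum‖ ≤ ε * S.card := by
  obtain ⟨M, hM⟩ := (hasCompactSupport_dbar hc).exists_bound_of_continuous (continuous_dbar hg)
  have hM0 : 0 ≤ M := (norm_nonneg _).trans (hM 0)
  obtain ⟨R', hR'⟩ := (hasCompactSupport_dbar hc).isCompact.isBounded.subset_closedBall (0 : ℂ)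
  set R := max R' 1
  have hR : tsupport (dbar g) ⊆ Metric.closedBall 0 R :=
    hR'.trans (Metric.closedBall_subset_closedBall (le_max_left _ _))
  set V := volume.real (Metric.closedBall (0 : ℂ) R)
  have hV : 0 ≤ V := measureReal_nonneg
  -- With r = τ/8 and area below rτ/4, the error is Mτ(3/2 + π/2) per point, at most πε because 3 ≤
  -- π.
  set τ := ε / (M + 1) with hτ
  have hτ0 : 0 < τ := by positivity
  set r := τ / 8 with hr
  have hr0 : 0 < r := by positivity
  obtain ⟨k, hk⟩ := ((tendsto_volume_nearCross R).eventually
    (gt_mem_nhds (show 0 < r * τ / 4 by positivity))).exists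
  refine ⟨R, lt_of_lt_of_le one_pos (le_max_right _ _), 1 / ((k : ℝ) + 1), by positivity,
    τ / (V + 1), by positivity, fun S T hST h => ?_⟩
  have h1 := norm_sum_sub_sum_le hg hc hM hR (measurableSet_nearCross R (1 / ((k : ℝ) + 1)))
    (nearCross_subset _ _) hr0 hST (κ := τ / (V + 1))
    (fun z hz => h z (by simpa using hz.1) hz.2)
  have h2 : τ / (V + 1) * volume.real (Metric.closedBall (0 : ℂ) R \
      nearCross R (1 / ((k : ℝ) + 1))) ≤ τ := by
    have h3 : volume.real (Metric.closedBall (0 : ℂ) R \ nearCross R (1 / ((k : ℝ) + 1))) ≤ V + 1 :=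
      (measureReal_mono Set.sdiff_subset (isCompact_closedBall _ _).measure_lt_top.ne).trans
        (by linarith)
    calc _ ≤ τ / (V + 1) * (V + 1) := by gcongr
      _ = τ := by field_simp
  have h3 : volume.real (nearCross R (1 / ((k : ℝ) + 1))) * r⁻¹ ≤ τ / 4 := by
    rw [← div_eq_mul_inv, div_le_iff₀ hr0]
    linarith
  have hN : (0 : ℝ) ≤ S.card := Nat.cast_nonneg _
  have hMτ : M * τ ≤ ε := by
    rw [hτ, mul_div_assoc', div_le_iff₀ (by positivity)]
    nlinarith
  have hpi := Real.pi_gt_three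
  have h4 : Real.pi * ‖(S.map g).sum - (T.map g).sum‖ ≤ Real.pi * (ε * S.card) := by
    calc _ ≤ _ := h1
      _ ≤ M * (S.card * (τ + 2 * (τ / 4 + 2 * Real.pi * r))) := by gcongr
      _ = (M * τ) * S.card * (3 / 2 + Real.pi / 2) := by rw [hr]; ring
      _ ≤ ε * S.card * Real.pi := by
        gcongr
        linarith
      _ = _ := by ring
  exact le_of_mul_le_mul_left h4 Real.pi_pos

/-! ### The trace of the resolvent -/

section Resolvent

variable {κ : Type*} [Fintype κ] [DecidableEq κ]

/-- The Cauchy transform of the eigenvalues is the trace of the resolvent. -/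
lemma cauchySum_roots_charpoly (M : Matrix κ κ ℂ) {z : ℂ}
    (hz : IsUnit (Matrix.scalar κ z - M).det) :
    cauchySum M.charpoly.roots z = ((Matrix.scalar κ z - M)⁻¹).trace := by
  set Q := Matrix.scalar κ z - M with hQ
  have hev : M.charpoly.eval z = Q.det := Matrix.eval_charpoly M z
  have hne : M.charpoly.eval z ≠ 0 := by rw [hev]; exact hz.ne_zero
  -- Expand det(z + t - M) = det Q · det(1 + t Q⁻¹) at t = 0: the linear coefficient is a trace, so
  -- the logarithmic derivative of the characteristic polynomial is the trace of Q⁻¹.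
  have hcomp : M.charpoly.comp (Polynomial.X + Polynomial.C z) = Polynomial.C Q.det *
      Matrix.det (1 + (Polynomial.X : Polynomial ℂ) • (Q⁻¹).map Polynomial.C) := by
    refine Polynomial.funext fun t => ?_
    rw [Polynomial.eval_comp, Matrix.eval_charpoly, Polynomial.eval_mul, Polynomial.eval_C]
    have h1 : Polynomial.eval t (Matrix.det (1 + (Polynomial.X : Polynomial ℂ) •
        (Q⁻¹).map Polynomial.C)) = (1 + t • Q⁻¹).det := by
      rw [← Polynomial.coe_evalRingHom, RingHom.map_det]
      congr 1
      ext i j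
      simp [Matrix.one_apply, apply_ite]
      exact mul_comm _ _
    rw [h1, ← Matrix.det_mul, mul_add, mul_one, Matrix.mul_smul, Matrix.mul_nonsing_inv _ hz]
    congr 1
    ext i j
    simp [hQ, Matrix.one_apply, Matrix.diagonal_apply]
    split_ifs <;> ring
  have hder : M.charpoly.derivative.eval z = M.charpoly.eval z * (Q⁻¹).trace := by
    have := congrArg (fun p => Polynomial.eval 0 (Polynomial.derivative p)) hcomp
    simpa [Polynomial.derivative_comp, Matrix.derivative_det_one_add_X_smul, hev] using this
  unfold cauchySum
  rw [← (IsAlgClosed.splits M.charpoly).eval_derivative_div_eval_of_ne_zero hne, hder,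
    mul_div_cancel_left₀ _ hne]

end Resolvent

/-! ### Matrices bounded below -/

open scoped Matrix.Norms.L2Operator

section BoundedBelow

variable {κ : Type*} [Fintype κ] [DecidableEq κ]

/-- `‖M v‖ ≥ c ‖v‖` for all `v`, in the Euclidean norm. -/
def BoundedBelow (M : Matrix κ κ ℂ) (c : ℝ) : Prop :=
  ∀ v : EuclideanSpace ℂ κ, c * ‖v‖ ≤ ‖Matrix.toEuclideanCLM (𝕜 := ℂ) M v‖

lemma BoundedBelow.isUnit_det {M : Matrix κ κ ℂ} {c : ℝ} (hM : BoundedBelow M c) (hc : 0 < c) :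
    IsUnit M.det := by
  rw [← Matrix.isUnit_iff_isUnit_det, ← Matrix.mulVec_injective_iff_isUnit]
  refine (injective_iff_map_eq_zero (Matrix.mulVecLin M)).2 fun v hv => ?_
  have h := hM (WithLp.toLp 2 v)
  rw [Matrix.toEuclideanCLM_toLp] at h
  rw [Matrix.mulVecLin_apply] at hv
  rw [hv] at h
  simp only [WithLp.toLp_zero, norm_zero] at h
  have h2 : ‖(WithLp.toLp 2 v : EuclideanSpace ℂ κ)‖ = 0 :=
    le_antisymm (by nlinarith [norm_nonneg (WithLp.toLp 2 v : EuclideanSpace ℂ κ)]) (norm_nonneg _)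
  simpa using h2

lemma BoundedBelow.norm_inv_le {M : Matrix κ κ ℂ} {c : ℝ} (hM : BoundedBelow M c) (hc : 0 < c) :
    ‖M⁻¹‖ ≤ c⁻¹ := by
  rw [Matrix.cstar_norm_def]
  refine ContinuousLinearMap.opNorm_le_bound _ (by positivity) fun v => ?_
  have h := hM (Matrix.toEuclideanCLM (𝕜 := ℂ) M⁻¹ v)
  have h1 : Matrix.toEuclideanCLM (𝕜 := ℂ) M (Matrix.toEuclideanCLM (𝕜 := ℂ) M⁻¹ v) = v := by
    change (Matrix.toEuclideanCLM (𝕜 := ℂ) M * Matrix.toEuclideanCLM (𝕜 := ℂ) M⁻¹) v = v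
    rw [← map_mul, Matrix.mul_nonsing_inv _ (hM.isUnit_det hc), map_one]
    rfl
  rw [h1] at h
  rw [inv_mul_eq_div, le_div_iff₀ hc, mul_comm]
  exact h

lemma BoundedBelow.add {M E : Matrix κ κ ℂ} {c δ : ℝ} (hM : BoundedBelow M c) (hE : ‖E‖ ≤ δ) :
    BoundedBelow (M + E) (c - δ) := by
  intro v
  have h1 := hM v
  have h2 : ‖Matrix.toEuclideanCLM (𝕜 := ℂ) E v‖ ≤ δ * ‖v‖ := by
    refine (ContinuousLinearMap.le_opNorm _ v).trans ?_
    rw [← Matrix.cstar_norm_def]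
    gcongr
  rw [map_add, _root_.add_apply]
  have h3 := norm_sub_le_norm_add (Matrix.toEuclideanCLM (𝕜 := ℂ) M v)
    (Matrix.toEuclideanCLM (𝕜 := ℂ) E v)
  linarith

lemma norm_entry_le_opNorm (M : Matrix κ κ ℂ) (i j : κ) : ‖M i j‖ ≤ ‖M‖ := by
  have h1 := ContinuousLinearMap.le_opNorm (Matrix.toEuclideanCLM (𝕜 := ℂ) M)
    (EuclideanSpace.single j (1 : ℂ))
  rw [← Matrix.cstar_norm_def] at h1
  simp only [PiLp.norm_single, norm_one, mul_one] at h1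
  refine le_trans (le_trans (le_of_eq ?_) (PiLp.norm_apply_le _ i)) h1
  rw [Matrix.ofLp_toEuclideanCLM]
  simp

lemma norm_trace_le (M : Matrix κ κ ℂ) : ‖M.trace‖ ≤ Fintype.card κ * ‖M‖ := by
  refine (norm_sum_le _ _).trans ?_
  refine (Finset.sum_le_sum fun i _ => norm_entry_le_opNorm M i i).trans ?_
  simp

/-- Perturbation bound for the Cauchy transform of the spectrum. -/
lemma norm_cauchySum_sub_le {M E : Matrix κ κ ℂ} {z : ℂ} {c δ : ℝ} (hc : 0 < c)
    (hM : BoundedBelow (Matrix.scalar κ z - M) c) (hE : ‖E‖ ≤ δ) (hδ : δ ≤ c / 2) :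
    ‖cauchySum (M + E).charpoly.roots z - cauchySum M.charpoly.roots z‖ ≤
      2 * δ / c ^ 2 * Fintype.card κ := by
  -- Only `M` is assumed to have a good resolvent; the perturbed matrix inherits half of the lower
  -- bound.
  have hM' : BoundedBelow (Matrix.scalar κ z - (M + E)) (c / 2) := by
    have h1 := hM.add (E := -E) (δ := δ) (by rwa [norm_neg])
    have h2 : Matrix.scalar κ z - (M + E) = Matrix.scalar κ z - M + -E := by abel
    rw [h2]
    intro v
    exact le_trans (by gcongr; linarith) (h1 v)
  have hc2 : 0 < c / 2 := by positivity
  have hu := hM.isUnit_det hc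
  have hu' := hM'.isUnit_det hc2
  rw [cauchySum_roots_charpoly _ hu, cauchySum_roots_charpoly _ hu', ← Matrix.trace_sub]
  set Q := Matrix.scalar κ z - M
  set Q' := Matrix.scalar κ z - (M + E)
  have hE' : E = Q - Q' := by simp [Q, Q']
  have hid : Q'⁻¹ - Q⁻¹ = Q'⁻¹ * E * Q⁻¹ := by
    rw [hE', mul_sub, sub_mul, Matrix.nonsing_inv_mul _ hu', one_mul, Matrix.mul_assoc,
      Matrix.mul_nonsing_inv _ hu, mul_one]
  refine (norm_trace_le _).trans ?_
  rw [mul_comm, hid]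
  gcongr
  have hδ0 : 0 ≤ δ := (norm_nonneg E).trans hE
  calc ‖Q'⁻¹ * E * Q⁻¹‖ ≤ ‖Q'⁻¹‖ * ‖E‖ * ‖Q⁻¹‖ := by
        refine (norm_mul_le _ _).trans ?_
        gcongr
        exact norm_mul_le _ _
    _ ≤ (c / 2)⁻¹ * δ * c⁻¹ := by
        gcongr
        · exact hM'.norm_inv_le hc2
        · exact hM.norm_inv_le hc
    _ = 2 * δ / c ^ 2 := by field_simp

/-- As ⟨x, Ax⟩ is real, ⟨x, (A - w)x⟩ has imaginary part -Im(w)‖x‖²; Cauchy–Schwarz finishes. -/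
lemma isHermitian_boundedBelow {A : Matrix κ κ ℂ} (hA : A.IsHermitian) (w : ℂ) :
    BoundedBelow (A - Matrix.scalar κ w) |w.im| := by
  intro x
  set T := Matrix.toEuclideanCLM (𝕜 := ℂ) A
  have h0 : (inner ℂ x (T x)).im = 0 := by
    exact (Matrix.isSymmetric_toEuclideanLin_iff.mpr hA).im_inner_self_apply x
  have h1 : Matrix.toEuclideanCLM (𝕜 := ℂ) (A - Matrix.scalar κ w) x = T x - w • x := by
    rw [map_sub, _root_.sub_apply]
    congr 1
    ext i
    rw [Matrix.ofLp_toEuclideanCLM]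
    simp [Matrix.mulVec_diagonal]
  rw [h1]
  have h2 : (inner ℂ x (T x - w • x)).im = - (w.im * ‖x‖ ^ 2) := by
    rw [inner_sub_right, inner_smul_right, inner_self_eq_norm_sq_to_K, Complex.sub_im, h0]
    simp [← Complex.ofReal_pow]
  have h3 : |w.im| * ‖x‖ ^ 2 ≤ ‖x‖ * ‖T x - w • x‖ := by
    calc |w.im| * ‖x‖ ^ 2 = |(inner ℂ x (T x - w • x)).im| := by
          rw [h2, abs_neg, abs_mul, abs_of_nonneg (sq_nonneg ‖x‖)]
      _ ≤ ‖inner ℂ x (T x - w • x)‖ := Complex.abs_im_le_norm _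
      _ ≤ _ := norm_inner_le_norm _ _
  rcases (norm_nonneg x).eq_or_lt with hx | hx
  · rw [← hx, mul_zero]; exact norm_nonneg _
  · refine le_of_mul_le_mul_left ?_ hx
    linarith

end BoundedBelow

/-! ### The linearization of `z² - z A + 1 + d` -/

section Companion

variable {ι : Type*}

/-- The block matrix `[[A, -(1 + d)], [1, 0]]`, with `d` diagonal. -/
def companion [DecidableEq ι] (A : Matrix ι ι ℂ) (d : ι → ℂ) : Matrix (ι ⊕ ι) (ι ⊕ ι) ℂ :=
  Matrix.fromBlocks A (-(1 + Matrix.diagonal d)) 1 0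

lemma companion_eq_add [DecidableEq ι] (A : Matrix ι ι ℂ) (d : ι → ℂ) :
    companion A d = companion A 0 + Matrix.fromBlocks 0 (-Matrix.diagonal d) 0 0 := by
  simp [companion, Matrix.fromBlocks_add]
  abel

variable [Fintype ι]

lemma norm_sq_sum_type (v : EuclideanSpace ℂ (ι ⊕ ι)) :
    ‖v‖ ^ 2 = ‖(WithLp.toLp 2 fun i => v (Sum.inl i) : EuclideanSpace ℂ ι)‖ ^ 2 +
      ‖(WithLp.toLp 2 fun i => v (Sum.inr i) : EuclideanSpace ℂ ι)‖ ^ 2 := by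
  simp [EuclideanSpace.norm_sq_eq, Fintype.sum_sum_type]

lemma norm_inl_le (v : EuclideanSpace ℂ (ι ⊕ ι)) :
    ‖(WithLp.toLp 2 fun i => v (Sum.inl i) : EuclideanSpace ℂ ι)‖ ≤ ‖v‖ :=
  le_of_sq_le_sq (by rw [norm_sq_sum_type v]; exact le_add_of_nonneg_right (sq_nonneg _))
    (norm_nonneg _)

lemma norm_inr_le (v : EuclideanSpace ℂ (ι ⊕ ι)) :
    ‖(WithLp.toLp 2 fun i => v (Sum.inr i) : EuclideanSpace ℂ ι)‖ ≤ ‖v‖ :=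
  le_of_sq_le_sq (by rw [norm_sq_sum_type v]; exact le_add_of_nonneg_left (sq_nonneg _))
    (norm_nonneg _)

lemma norm_le_inl_add_inr (v : EuclideanSpace ℂ (ι ⊕ ι)) :
    ‖v‖ ≤ ‖(WithLp.toLp 2 fun i => v (Sum.inl i) : EuclideanSpace ℂ ι)‖ +
      ‖(WithLp.toLp 2 fun i => v (Sum.inr i) : EuclideanSpace ℂ ι)‖ :=
  le_of_sq_le_sq (by
    rw [norm_sq_sum_type v]
    nlinarith [norm_nonneg (WithLp.toLp 2 fun i => v (Sum.inl i) : EuclideanSpace ℂ ι),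
      norm_nonneg (WithLp.toLp 2 fun i => v (Sum.inr i) : EuclideanSpace ℂ ι)]) (by positivity)

variable [DecidableEq ι]

lemma norm_diagonal_block_le {d : ι → ℂ} {δ : ℝ} (hδ : 0 ≤ δ) (hd : ∀ i, ‖d i‖ ≤ δ) :
    ‖Matrix.fromBlocks (0 : Matrix ι ι ℂ) (-Matrix.diagonal d) (0 : Matrix ι ι ℂ)
      (0 : Matrix ι ι ℂ)‖ ≤ δ := by
  rw [Matrix.cstar_norm_def]
  refine ContinuousLinearMap.opNorm_le_bound _ hδ fun v => ?_
  refine le_of_sq_le_sq ?_ (by positivity)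
  rw [EuclideanSpace.norm_sq_eq, mul_pow, EuclideanSpace.norm_sq_eq v, Fintype.sum_sum_type,
    Fintype.sum_sum_type, Matrix.ofLp_toEuclideanCLM, Matrix.fromBlocks_mulVec, mul_add]
  have h1 : ∑ i, ‖d i * v (Sum.inr i)‖ ^ 2 ≤ δ ^ 2 * ∑ i, ‖v (Sum.inr i)‖ ^ 2 := by
    rw [Finset.mul_sum]
    refine Finset.sum_le_sum fun i _ => ?_
    rw [norm_mul, mul_pow]
    gcongr
    exact hd i
  have h2 : 0 ≤ δ ^ 2 * ∑ i, ‖v (Sum.inl i)‖ ^ 2 := by positivity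
  simp [Matrix.mulVec_diagonal] at h1 ⊢
  linarith

/-- The lower bound for `z - companion A 0`, with a constant depending only on bounds for `|z|` and
`|Im (z + 1/z)|`. -/
lemma boundedBelow_companion {A : Matrix ι ι ℂ} (hA : A.IsHermitian) {z : ℂ} {ρ θ : ℝ}
    (hρ : 0 < ρ) (hθ : 0 < θ) (hz : ρ ≤ ‖z‖) (hw : θ ≤ |(z + 1 / z).im|) :
    BoundedBelow (Matrix.scalar (ι ⊕ ι) z - companion A 0)
      ((1 + 1 / ρ) / θ + ((1 + 1 / ρ) / θ + 1) / ρ)⁻¹ := by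
  intro v
  have hz0 : z ≠ 0 := norm_pos_iff.1 (hρ.trans_le hz)
  set V := Matrix.toEuclideanCLM (𝕜 := ℂ) (Matrix.scalar (ι ⊕ ι) z - companion A 0) v with hV
  set x : EuclideanSpace ℂ ι := WithLp.toLp 2 fun i => v (Sum.inl i) with hx
  set y : EuclideanSpace ℂ ι := WithLp.toLp 2 fun i => v (Sum.inr i) with hy
  set a : EuclideanSpace ℂ ι := WithLp.toLp 2 fun i => V (Sum.inl i) with ha
  set b : EuclideanSpace ℂ ι := WithLp.toLp 2 fun i => V (Sum.inr i) with hb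
  have hVl : ∀ i, V (Sum.inl i) = z * x i - (A.mulVec x) i + y i := by
    intro i
    rw [hV, Matrix.ofLp_toEuclideanCLM, Matrix.sub_mulVec, companion, Matrix.fromBlocks_mulVec]
    simp [Matrix.neg_mulVec, hx, hy]
    simp [Function.comp_def]
    ring
  have hVr : ∀ i, V (Sum.inr i) = z * y i - x i := by
    intro i
    rw [hV, Matrix.ofLp_toEuclideanCLM, Matrix.sub_mulVec, companion, Matrix.fromBlocks_mulVec]
    simp [hx, hy]
  -- The lower block row gives y = (x + b)/z; substituted in the upper row it leaves an equation in
  -- x alone, to which the Hermitian bound applies.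
  have e1 : Matrix.toEuclideanCLM (𝕜 := ℂ) (A - Matrix.scalar ι (z + 1 / z)) x =
      (1 / z) • b - a := by
    ext i
    rw [Matrix.ofLp_toEuclideanCLM, Matrix.sub_mulVec]
    simp [ha, hb, hVl, hVr]
    field_simp
    ring
  have e2 : y = (1 / z) • (x + b) := by
    ext i
    simp [hb, hVr]
    field_simp
    ring
  have hna : ‖a‖ ≤ ‖V‖ := norm_inl_le V
  have hnb : ‖b‖ ≤ ‖V‖ := norm_inr_le V
  have hiz : ‖1 / z‖ ≤ 1 / ρ := by
    rw [norm_div, norm_one]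
    exact one_div_le_one_div_of_le hρ hz
  have h1 : θ * ‖x‖ ≤ (1 + 1 / ρ) * ‖V‖ := by
    have h2 := isHermitian_boundedBelow hA (z + 1 / z) x
    rw [e1] at h2
    calc θ * ‖x‖ ≤ |(z + 1 / z).im| * ‖x‖ := by gcongr
      _ ≤ ‖(1 / z) • b - a‖ := h2
      _ ≤ ‖1 / z‖ * ‖b‖ + ‖a‖ := by
        refine (norm_sub_le _ _).trans ?_
        rw [norm_smul]
      _ ≤ 1 / ρ * ‖V‖ + ‖V‖ := by gcongr
      _ = _ := by ring
  have h3 : ‖x‖ ≤ (1 + 1 / ρ) / θ * ‖V‖ := by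
    rw [div_mul_eq_mul_div, le_div_iff₀ hθ]
    linarith
  have h4 : ‖y‖ ≤ ((1 + 1 / ρ) / θ + 1) / ρ * ‖V‖ := by
    calc ‖y‖ ≤ ‖1 / z‖ * (‖x‖ + ‖b‖) := by
          rw [e2, norm_smul]
          gcongr
          exact norm_add_le _ _
      _ ≤ 1 / ρ * ((1 + 1 / ρ) / θ * ‖V‖ + ‖V‖) := by gcongr
      _ = _ := by ring
  have h5 := norm_le_inl_add_inr v
  rw [inv_mul_eq_div, div_le_iff₀ (by positivity)]
  linarith

end Companion

/-- The numerator is the quantity that defines `nearCross`: z + 1/z is real exactly on the real line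
and the unit circle. -/
lemma im_add_one_div (z : ℂ) (hz : z ≠ 0) :
    |(z + 1 / z).im| = |z.im| * |‖z‖ ^ 2 - 1| / ‖z‖ ^ 2 := by
  have h : ‖z‖ ^ 2 ≠ 0 := by simpa using hz
  have h1 : (z + 1 / z).im = z.im * (‖z‖ ^ 2 - 1) / ‖z‖ ^ 2 := by
    rw [one_div, Complex.add_im, Complex.inv_im, Complex.normSq_eq_norm_sq]
    field_simp
    ring
  rw [h1, abs_div, abs_mul, abs_of_nonneg (sq_nonneg ‖z‖)]

/-- Off `nearCross R η`, the Cauchy transforms of the spectra of `companion A d` and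
`companion A 0` are close, uniformly in the size of the matrices. -/
lemma exists_forall_cauchySum_companion_le {R η τ : ℝ} (hR : 0 < R) (hη : 0 < η) (hτ : 0 < τ) :
    ∃ δ > 0, ∀ (n : ℕ) (A : Matrix (Fin n) (Fin n) ℂ), A.IsHermitian → ∀ d : Fin n → ℂ,
      (∀ i, ‖d i‖ ≤ δ) → ∀ z, ‖z‖ ≤ R → z ∉ nearCross R η →
      ‖cauchySum (companion A d).charpoly.roots z - cauchySum (companion A 0).charpoly.roots z‖ ≤
        τ * Fintype.card (Fin n ⊕ Fin n) := by
  -- Off `nearCross R η`, η < |Im z|·||z|² - 1| ≤ |z|(R² + 1), which gives ρ; dividing the first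
  -- inequality by |z|² ≤ R² gives θ.
  set ρ := η / (R ^ 2 + 1) with hρ
  set θ := η / R ^ 2 with hθ
  have hρ0 : 0 < ρ := by positivity
  have hθ0 : 0 < θ := by positivity
  set c := ((1 + 1 / ρ) / θ + ((1 + 1 / ρ) / θ + 1) / ρ)⁻¹ with hc
  have hc0 : 0 < c := by positivity
  -- c/2 keeps the perturbed matrix invertible; τc²/2 turns the resolvent bound 2δ/c² into τ.
  refine ⟨min (c / 2) (τ * c ^ 2 / 2), by positivity, fun n A hA d hd z hzR hz => ?_⟩
  have h1 : η < |z.im| * |‖z‖ ^ 2 - 1| := by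
    by_contra h
    exact hz ⟨hzR, not_lt.1 h⟩
  have h2 : |‖z‖ ^ 2 - 1| ≤ R ^ 2 + 1 := by
    have : ‖z‖ ^ 2 ≤ R ^ 2 := by gcongr
    rw [abs_le]
    constructor <;> nlinarith [sq_nonneg ‖z‖]
  have hz1 : ρ ≤ ‖z‖ := by
    rw [hρ, div_le_iff₀ (by positivity)]
    refine h1.le.trans ?_
    gcongr
    exact Complex.abs_im_le_norm z
  have hz0 : z ≠ 0 := norm_pos_iff.1 (hρ0.trans_le hz1)
  have hw : θ ≤ |(z + 1 / z).im| := by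
    rw [im_add_one_div z hz0, hθ]
    have : 0 < ‖z‖ := norm_pos_iff.2 hz0
    gcongr
  have hb := boundedBelow_companion hA hρ0 hθ0 hz1 hw
  have h3 := norm_cauchySum_sub_le hc0 hb
    (norm_diagonal_block_le (by positivity) hd) (min_le_left _ _)
  rw [← companion_eq_add] at h3
  refine h3.trans ?_
  gcongr
  rw [div_le_iff₀ (by positivity)]
  linarith [min_le_right (c / 2) (τ * c ^ 2 / 2)]

/-! ### The spectrum of `companion A 0` -/

section Tightness

variable {ι : Type*} [Fintype ι] [DecidableEq ι]

open Polynomial in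
-- For z ≠ 0 the Schur complement of the lower right block gives ∏ z(z + 1/z - λᵢ), and agreement on
-- an infinite set suffices.
lemma charpoly_companion_zero {A : Matrix ι ι ℂ} (hA : A.IsHermitian) :
    (companion A 0).charpoly = ∏ i, (X ^ 2 - Polynomial.C (hA.eigenvalues i : ℂ) * X + 1) := by
  refine eq_of_infinite_eval_eq _ _ (Set.Infinite.mono (s := {0}ᶜ) ?_
    (Set.finite_singleton 0).infinite_compl)
  intro z hz
  have hz0 : z ≠ 0 := hz
  have hinv : Invertible (Matrix.scalar ι z) :=
    Matrix.invertibleOfIsUnitDet _ (by simp [hz0])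
  have h1 : Matrix.scalar (ι ⊕ ι) z - companion A 0 =
      Matrix.fromBlocks (Matrix.scalar ι z - A) 1 (-1) (Matrix.scalar ι z) := by
    ext (i | i) (j | j) <;>
      simp [companion, Matrix.diagonal_apply, Matrix.one_apply]
  have h2 : ⅟(Matrix.scalar ι z) = Matrix.scalar ι (1 / z) := by
    refine invOf_eq_right_inv ?_
    rw [← map_mul, mul_one_div_cancel hz0, map_one]
  have h3 : Matrix.scalar ι z - A - 1 * Matrix.scalar ι (1 / z) * -1 =
      Matrix.scalar ι (z + 1 / z) - A := by
    rw [map_add]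
    simp only [one_mul, mul_neg, mul_one]
    abel
  change eval z _ = eval z _
  rw [Matrix.eval_charpoly, h1, Matrix.det_fromBlocks₂₂, h2, h3, ← Matrix.eval_charpoly,
    hA.charpoly_eq, eval_prod, eval_prod]
  simp only [Matrix.scalar_apply, Matrix.det_diagonal]
  rw [← Finset.prod_mul_distrib]
  refine Finset.prod_congr rfl fun i _ => ?_
  simp
  field_simp
  ring

lemma trace_mul_self_eq_sum_eigenvalues {A : Matrix ι ι ℂ} (hA : A.IsHermitian) :
    (A * A).trace.re = ∑ i, hA.eigenvalues i ^ 2 := by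
  have h := hA.spectral_theorem
  rw [Unitary.conjStarAlgAut_apply] at h
  set U := (hA.eigenvectorUnitary : Matrix ι ι ℂ)
  set D : Matrix ι ι ℂ := Matrix.diagonal (RCLike.ofReal ∘ hA.eigenvalues)
  have hU : star U * U = 1 := Unitary.coe_star_mul_self _
  have h1 : (A * A).trace = (D * D).trace := by
    calc (A * A).trace = (U * D * star U * (U * D * star U)).trace := by rw [← h]
      _ = (U * (D * D) * star U).trace := by
        congr 1
        calc _ = U * D * (star U * U) * D * star U := by simp only [mul_assoc]
          _ = _ := by rw [hU]; simp only [mul_assoc, one_mul]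
      _ = _ := by rw [Matrix.trace_mul_cycle, hU, one_mul]
  rw [h1, Matrix.diagonal_mul_diagonal, Matrix.trace_diagonal, Complex.re_sum]
  refine Finset.sum_congr rfl fun i _ => ?_
  simp [sq]

open Polynomial in
/-- The eigenvalues of `companion A 0` outside of a disc are controlled by the trace of `A²`. -/
lemma sum_roots_companion_zero_le {A : Matrix ι ι ℂ} (hA : A.IsHermitian) {h : ℂ → ℝ} {R : ℝ}
    (hR : 1 < R) (h1 : ∀ z, h z ≤ 1) (h0 : ∀ z, ‖z‖ ≤ R → h z = 0) :
    ((companion A 0).charpoly.roots.map h).sum ≤ 2 * (A * A).trace.re / (R - 1) ^ 2 := by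
  have hR' : 0 < R - 1 := by linarith
  have hmon : ∀ i, (X ^ 2 - Polynomial.C (hA.eigenvalues i : ℂ) * X + 1 : ℂ[X]).natDegree ≤ 2 := fun i => by
    compute_degree
  have hne : (∏ i, (X ^ 2 - Polynomial.C (hA.eigenvalues i : ℂ) * X + 1 : ℂ[X])) ≠ 0 := by
    rw [← charpoly_companion_zero hA]
    exact (Matrix.charpoly_monic _).ne_zero
  rw [charpoly_companion_zero hA, roots_prod _ _ hne, Multiset.map_bind, Multiset.sum_bind,
    trace_mul_self_eq_sum_eigenvalues hA, Finset.mul_sum, Finset.sum_div]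
  refine Finset.sum_le_sum fun i _ => ?_
  set l := hA.eigenvalues i
  -- Chebyshev's inequality: a root with |z| > R satisfies |z|² ≤ |l||z| + 1, which forces |l| ≥ R -
  -- 1.
  have hroot : ∀ z ∈ (X ^ 2 - Polynomial.C (l : ℂ) * X + 1 : ℂ[X]).roots, h z ≤ l ^ 2 / (R - 1) ^ 2 := by
    intro z hz
    by_cases hzR : ‖z‖ ≤ R
    · rw [h0 z hzR]; positivity
    · refine (h1 z).trans ?_
      rw [one_le_div (by positivity)]
      have hzR' : R < ‖z‖ := not_le.1 hzR
      have he : z ^ 2 - l * z + 1 = 0 := by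
        have := (mem_roots'.1 hz).2
        simpa [IsRoot] using this
      have h2 : ‖z‖ ^ 2 ≤ |l| * ‖z‖ + 1 := by
        calc ‖z‖ ^ 2 = ‖(l : ℂ) * z - 1‖ := by
              rw [← norm_pow]; congr 1; linear_combination he
          _ ≤ ‖(l : ℂ) * z‖ + ‖(1 : ℂ)‖ := norm_sub_le _ _
          _ = _ := by simp
      have h3 : R - 1 ≤ |l| := by
        by_contra hcon
        nlinarith
      rw [← sq_abs l]
      gcongr
  refine (Multiset.sum_le_card_nsmul _ (l ^ 2 / (R - 1) ^ 2) ?_).trans ?_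
  · intro x hx
    obtain ⟨z, hz, rfl⟩ := Multiset.mem_map.1 hx
    exact hroot z hz
  · rw [Multiset.card_map, nsmul_eq_mul, mul_div_assoc]
    gcongr
    exact_mod_cast (card_roots' _).trans (hmon i)

end Tightness

lemma card_roots_charpoly {κ : Type*} [Fintype κ] [DecidableEq κ] (M : Matrix κ κ ℂ) :
    M.charpoly.roots.card = Fintype.card κ := by
  rw [← (IsAlgClosed.splits M.charpoly).natDegree_eq_card_roots, Matrix.charpoly_natDegree_eq_dim]

/-! ### Comparison of the spectra of `companion A d` and `companion A 0` -/

/-- Smooth test functions. -/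
lemma exists_forall_abs_sum_companion_le_of_contDiff {g : ℂ → ℝ} (hg : ContDiff ℝ 1 g)
    (hc : HasCompactSupport g) {ε : ℝ} (hε : 0 < ε) :
    ∃ δ > 0, ∀ (n : ℕ) (A : Matrix (Fin n) (Fin n) ℂ), A.IsHermitian → ∀ d : Fin n → ℂ,
      (∀ i, ‖d i‖ ≤ δ) →
      |((companion A d).charpoly.roots.map g).sum - ((companion A 0).charpoly.roots.map g).sum| ≤
        ε * Fintype.card (Fin n ⊕ Fin n) := by
  have hg' : ContDiff ℝ 1 fun z => (g z : ℂ) := Complex.ofRealCLM.contDiff.comp hg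
  have hc' : HasCompactSupport fun z => (g z : ℂ) := hc.comp_left (g := Complex.ofReal) rfl
  obtain ⟨R, hR, η, hη, κ, hκ, h⟩ := exists_forall_norm_sum_sub_sum_le hg' hc' hε
  obtain ⟨δ, hδ, h'⟩ := exists_forall_cauchySum_companion_le hR hη hκ
  refine ⟨δ, hδ, fun n A hA d hd => ?_⟩
  have h1 := h (companion A d).charpoly.roots (companion A 0).charpoly.roots
    (by rw [card_roots_charpoly, card_roots_charpoly])
    (fun z hz hz' => by rw [card_roots_charpoly]; exact h' n A hA d hd z hz hz')
  rw [card_roots_charpoly] at h1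
  have hcast : ∀ S : Multiset ℂ, (S.map fun z => (g z : ℂ)).sum = (((S.map g).sum : ℝ) : ℂ) := by
    intro S
    induction S using Multiset.induction with
    | empty => simp
    | cons a S ih => simp [ih]
  rwa [hcast, hcast, ← Complex.ofReal_sub, Complex.norm_real, Real.norm_eq_abs] at h1

/-- For every bounded continuous `f`, the averages of `f` over the spectra of `companion A d` and
`companion A 0` are close if `d` is small, uniformly in the size of the matrices. -/
theorem exists_forall_abs_sum_companion_le (f : ℂ →ᵇ ℝ) {ε : ℝ} (hε : 0 < ε) :
    ∃ δ > 0, ∀ (n : ℕ) (A : Matrix (Fin n) (Fin n) ℂ), A.IsHermitian →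
      (A * A).trace.re ≤ 4 * n → ∀ d : Fin n → ℂ, (∀ i, ‖d i‖ ≤ δ) →
      |((companion A d).charpoly.roots.map f).sum - ((companion A 0).charpoly.roots.map f).sum| ≤
        ε * Fintype.card (Fin n ⊕ Fin n) := by
  set F := ‖f‖
  have hF : 0 ≤ F := norm_nonneg _
  -- Tails cost 2Fε₁ and Fε₁; two uniform approximations and one smooth comparison cost 3ε₁.
  set ε₁ := min 1 (ε / (3 * F + 3)) with hε₁
  have hε₁0 : 0 < ε₁ := by positivity
  have hε₁1 : ε₁ ≤ 1 := min_le_left _ _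
  -- With tr A² ≤ 4n the Chebyshev tail is at most 8n/(R - 1)² = 2nε₁² ≤ ε₁ · 2n.
  set R := 1 + 2 / ε₁ with hR
  have hR1 : 1 < R := by
    have : 0 < 2 / ε₁ := by positivity
    linarith
  let χ : ContDiffBump (0 : ℂ) := ⟨R, R + 1, by linarith, by linarith⟩
  obtain ⟨g₀, hg₀, hg₀f, -⟩ := f.continuous.exists_contDiff_approx 1 (ε := fun _ => ε₁)
    continuous_const (fun _ => hε₁0)
  set g : ℂ → ℝ := fun z => χ z * g₀ z with hgdef
  have hg : ContDiff ℝ 1 g := χ.contDiff.mul hg₀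
  have hgc : HasCompactSupport g := χ.hasCompactSupport.mul_right
  obtain ⟨δ₁, hδ₁, h₁⟩ := exists_forall_abs_sum_companion_le_of_contDiff hg hgc hε₁0
  -- The cutoff is itself a smooth test function; comparing it on both spectra transfers tightness
  -- from `companion A 0` to `companion A d`.
  obtain ⟨δ₂, hδ₂, h₂⟩ := exists_forall_abs_sum_companion_le_of_contDiff
    (χ.contDiff (n := 1)) χ.hasCompactSupport hε₁0
  refine ⟨min δ₁ δ₂, lt_min hδ₁ hδ₂, fun n A hA htr d hd => ?_⟩
  have k₁ := h₁ n A hA d fun i => (hd i).trans (min_le_left _ _)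
  have k₂ := h₂ n A hA d fun i => (hd i).trans (min_le_right _ _)
  set S := (companion A d).charpoly.roots with hS
  set T := (companion A 0).charpoly.roots with hT
  set N : ℝ := ((Fintype.card (Fin n ⊕ Fin n) : ℕ) : ℝ) with hN
  have hNn : N = 2 * n := by simp [hN]; ring
  have hN0 : 0 ≤ N := Nat.cast_nonneg _
  have hSc : (S.card : ℝ) = N := by rw [hS, card_roots_charpoly]
  have hTc : (T.card : ℝ) = N := by rw [hT, card_roots_charpoly]
  have htail : ∀ U : Multiset ℂ, (U.map fun z => 1 - χ z).sum = U.card - (U.map χ).sum := by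
    intro U
    rw [Multiset.sum_map_sub]
    simp
  have hTtail : T.card - (T.map χ).sum ≤ ε₁ * N := by
    rw [← htail]
    refine (sum_roots_companion_zero_le hA hR1 (fun z => by linarith [χ.nonneg (x := z)])
      (fun z hz => ?_)).trans ?_
    · rw [χ.one_of_mem_closedBall (by simpa using hz), sub_self]
    · rw [hR, add_sub_cancel_left, hNn, div_le_iff₀ (by positivity)]
      have h4 : ε₁ * (2 * n) * (2 / ε₁) ^ 2 = 8 * n / ε₁ := by field_simp; ring
      rw [h4, le_div_iff₀ hε₁0]
      have hn : (0 : ℝ) ≤ n := Nat.cast_nonneg n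
      nlinarith
  have hpt : ∀ z, |f z - g z| ≤ F * (1 - χ z) + ε₁ := by
    intro z
    have a1 := χ.nonneg (x := z)
    have a2 := χ.le_one (x := z)
    have a3 : |f z| ≤ F := f.norm_coe_le_norm z
    have a4 : |f z - g₀ z| ≤ ε₁ := by
      have := hg₀f z
      rw [dist_comm, Real.dist_eq] at this
      exact this.le
    calc |f z - g z| = |f z * (1 - χ z) + χ z * (f z - g₀ z)| := by
          congr 1; simp only [hgdef]; ring
      _ ≤ |f z| * (1 - χ z) + χ z * |f z - g₀ z| := by
          refine (abs_add_le _ _).trans (le_of_eq ?_)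
          rw [abs_mul, abs_mul, abs_of_nonneg a1, abs_of_nonneg (sub_nonneg.2 a2)]
      _ ≤ F * (1 - χ z) + 1 * ε₁ := by
          have := sub_nonneg.2 a2
          gcongr
      _ = _ := by ring
  have hsum : ∀ U : Multiset ℂ, |(U.map f).sum - (U.map g).sum| ≤
      F * (U.card - (U.map χ).sum) + ε₁ * U.card := by
    intro U
    induction U using Multiset.induction with
    | empty => simp
    | cons a U ih =>
      have := hpt a
      simp only [Multiset.map_cons, Multiset.sum_cons, Multiset.card_cons] at ih ⊢
      push_cast
      rw [show f a + (U.map f).sum - (g a + (U.map g).sum) =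
        (f a - g a) + ((U.map f).sum - (U.map g).sum) by ring]
      refine (abs_add_le _ _).trans ?_
      linarith
  have hfS := hsum S
  have hfT := hsum T
  rw [hSc] at hfS
  rw [hTc] at hfT hTtail
  have hStail : N - (S.map χ).sum ≤ 2 * (ε₁ * N) := by
    have := (abs_le.1 k₂).1
    linarith
  have b1 : F * (N - (S.map χ).sum) ≤ F * (2 * (ε₁ * N)) := by gcongr
  have b2 : F * (N - (T.map χ).sum) ≤ F * (ε₁ * N) := by gcongr
  have b3 : (3 * F + 3) * ε₁ ≤ ε := by
    have : ε₁ ≤ ε / (3 * F + 3) := min_le_right _ _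
    rw [le_div_iff₀ (by positivity)] at this
    linarith
  have b4 : (3 * F + 3) * ε₁ * N ≤ ε * N := by gcongr
  rw [abs_le] at k₁ hfS hfT ⊢
  constructor <;> linarith [k₁.1, k₁.2, hfS.1, hfS.2, hfT.1, hfT.2]

/-! ### Edges and degrees of a binomial random graph -/

section RandomGraph

open scoped Classical in
/-- The degree of a vertex, as a real number. -/
noncomputable def realDegree {n : ℕ} (G : SimpleGraph (Fin n)) (i : Fin n) : ℝ :=
  ∑ j, if G.Adj i j then 1 else 0

variable {n : ℕ}

/-- Makes every function on this finite space measurable and integrable. -/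
instance : MeasurableSingletonClass (SimpleGraph (Fin n)) where
  measurableSet_singleton G := by
    have h : {G} = SimpleGraph.edgeSet ⁻¹' {SimpleGraph.edgeSet G} := by
      ext H
      simp
    rw [h]
    exact SimpleGraph.measurable_edgeSet (measurableSet_singleton _)

/-- Products of functions of single edges factorize in expectation. -/
lemma integral_prod_edges (p : unitInterval) (h : Sym2 (Fin n) → Prop → ℝ) :
    ∫ G, ∏ e, h e (e ∈ G.edgeSet) ∂(SimpleGraph.binomialRandom (Fin n) p) =
      ∏ e : Sym2 (Fin n), ((p : ℝ) * h e (¬ e.IsDiag) + (1 - (p : ℝ)) * h e False) := by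
  have hmeas : Measurable fun x : Sym2 (Fin n) → Prop => {e | x e} :=
    MeasurableEquiv.setOfPred.measurable
  rw [SimpleGraph.binomialRandom_eq_map, integral_map SimpleGraph.measurable_fromEdgeSet.aemeasurable
    (Measurable.of_discrete).aestronglyMeasurable]
  -- The random set almost surely contains no diagonal pair, so `fromEdgeSet` discards nothing.
  have hae : ∀ᵐ s ∂(setBernoulli (Sym2.diagSetᶜ : Set (Sym2 (Fin n))) p),
      ∏ e, h e (e ∈ (SimpleGraph.fromEdgeSet s).edgeSet) = ∏ e, h e (e ∈ s) := by
    filter_upwards [setBernoulli_ae_subset] with s hs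
    refine Finset.prod_congr rfl fun e _ => ?_
    congr 1
    rw [SimpleGraph.edgeSet_fromEdgeSet]
    simp only [Set.mem_sdiff, eq_iff_iff, and_iff_left_iff_imp]
    intro he hd
    exact hs he hd
  rw [integral_congr_ae hae, setBernoulli_eq_map, integral_map hmeas.aemeasurable
    (Measurable.of_discrete).aestronglyMeasurable]
  simp only [Set.mem_ofPred_eq]
  rw [Measure.infinitePi_eq_pi, integral_fintype_prod_eq_prod (fun e x => h e x)]
  refine Finset.prod_congr rfl fun e _ => ?_
  rw [integral_add_measure Integrable.of_finite Integrable.of_finite, integral_smul_nnreal_measure,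
    integral_smul_nnreal_measure, integral_dirac, integral_dirac]
  simp [NNReal.smul_def]

lemma integral_adj (p : unitInterval) (i j : Fin n) :
    ∫ G, adj G i j ∂(SimpleGraph.binomialRandom (Fin n) p) = if i = j then 0 else ((p : ℝ) : ℂ) := by
  classical
  -- A single edge indicator as a product over all pairs, with trivial factors elsewhere.
  let φ : Sym2 (Fin n) → Prop → ℝ := fun e x =>
    if e = s(i, j) then (if x then (1 : ℝ) else 0) else 1
  have h1 : ∀ G : SimpleGraph (Fin n), adj G i j = ((∏ e, φ e (e ∈ G.edgeSet) : ℝ) : ℂ) := by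
    intro G
    simp only [φ]
    rw [Finset.prod_ite_eq' Finset.univ]
    by_cases h : G.Adj i j <;> simp [adj, SimpleGraph.adjMatrix_apply, h]
  simp only [h1]
  rw [integral_complex_ofReal, integral_prod_edges p φ]
  have h3 : ∀ e, (p : ℝ) * φ e (¬ e.IsDiag) + (1 - (p : ℝ)) * φ e False =
      if e = s(i, j) then (if e.IsDiag then 0 else (p : ℝ)) else 1 := by
    intro e
    by_cases h : e = s(i, j) <;> by_cases h' : e.IsDiag <;> simp [φ, h, h']
  rw [Finset.prod_congr rfl fun e _ => h3 e, Finset.prod_ite_eq' Finset.univ]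
  simp only [Finset.mem_univ, if_true, Sym2.mk_isDiag_iff]
  split_ifs <;> simp

lemma expDegMatrix_eq (n : ℕ) (p : unitInterval) :
    expDegMatrix n p = Matrix.diagonal fun _ => ((((n : ℝ) - 1) * (p : ℝ) : ℝ) : ℂ) := by
  ext i j
  rw [expDegMatrix, Matrix.of_apply]
  by_cases hij : i = j
  · subst hij
    simp only [degMatrix, Matrix.diagonal_apply_eq]
    rw [integral_finsetSum _ fun j _ => Integrable.of_finite]
    simp only [integral_adj]
    rw [Finset.sum_ite, Finset.sum_const_zero, zero_add, Finset.sum_const, nsmul_eq_mul]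
    have hcard : (Finset.univ.filter fun j => ¬ i = j).card = n - 1 := by
      rw [Finset.filter_not, Finset.filter_eq, if_pos (Finset.mem_univ i),
        Finset.card_sdiff_of_subset (by simp)]
      simp
    rw [hcard, Nat.cast_sub (Fin.pos i)]
    push_cast
    ring
  · simp [degMatrix, Matrix.diagonal_apply_ne _ hij]

/-- The exponential is a product over the pairs containing i. The diagonal pair contributes 1, hence
the exponent n - 1. -/
lemma integral_exp_realDegree (p : unitInterval) (i : Fin n) (t : ℝ) :
    ∫ G, Real.exp (t * realDegree G i) ∂(SimpleGraph.binomialRandom (Fin n) p) =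
      (1 + (p : ℝ) * (Real.exp t - 1)) ^ (n - 1) := by
  classical
  set s : Finset (Sym2 (Fin n)) := Finset.univ.image fun j => s(i, j) with hs
  have hinj : Function.Injective fun j : Fin n => s(i, j) := fun j k h => by
    rcases Sym2.eq_iff.1 h with ⟨-, h⟩ | ⟨h, h'⟩
    · exact h
    · exact h'.trans h
  let φ : Sym2 (Fin n) → Prop → ℝ := fun e x =>
    if e ∈ s then (if x then Real.exp t else 1) else 1
  have h1 : ∀ G : SimpleGraph (Fin n), Real.exp (t * realDegree G i) =
      ∏ e, φ e (e ∈ G.edgeSet) := by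
    intro G
    simp only [φ]
    rw [Finset.prod_ite_mem, Finset.univ_inter, hs, Finset.prod_image fun _ _ _ _ h => hinj h,
      realDegree, Finset.mul_sum, Real.exp_sum]
    refine Finset.prod_congr rfl fun j _ => ?_
    by_cases h : G.Adj i j <;> simp [h]
  simp only [h1]
  rw [integral_prod_edges p φ]
  have h3 : ∀ e, (p : ℝ) * φ e (¬ e.IsDiag) + (1 - (p : ℝ)) * φ e False =
      if e ∈ s then (if e.IsDiag then 1 else 1 + (p : ℝ) * (Real.exp t - 1)) else 1 := by
    intro e
    by_cases h : e ∈ s <;> by_cases h' : e.IsDiag <;> simp [φ, h, h']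
    ring
  rw [Finset.prod_congr rfl fun e _ => h3 e, Finset.prod_ite_mem, Finset.univ_inter, hs,
    Finset.prod_image fun _ _ _ _ h => hinj h]
  simp only [Sym2.mk_isDiag_iff]
  rw [Finset.prod_ite, Finset.prod_const_one, one_mul, Finset.prod_const]
  congr 1
  rw [Finset.filter_not, Finset.filter_eq, if_pos (Finset.mem_univ i),
    Finset.card_sdiff_of_subset (by simp)]
  simp

/-- One-sided Chernoff bound, for `t` of either sign. -/
lemma measureReal_realDegree_le (p : unitInterval) (i : Fin n) {t a : ℝ} (ht : |t| ≤ 1) :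
    (SimpleGraph.binomialRandom (Fin n) p).real
      {G | a ≤ t * (realDegree G i - ((n : ℝ) - 1) * p)} ≤
      Real.exp (-a + t ^ 2 * (((n : ℝ) - 1) * p)) := by
  set m := ((n : ℝ) - 1) * (p : ℝ) with hm
  have hn : ((n - 1 : ℕ) : ℝ) = (n : ℝ) - 1 := by
    rw [Nat.cast_sub (Fin.pos i)]; simp
  have hm0 : 0 ≤ m := by
    rw [hm, ← hn]
    exact mul_nonneg (Nat.cast_nonneg _) p.2.1
  have h1 := mul_meas_ge_le_integral_of_nonneg (μ := SimpleGraph.binomialRandom (Fin n) p)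
    (f := fun G => Real.exp (t * realDegree G i)) (ae_of_all _ fun G => (Real.exp_pos _).le)
    Integrable.of_finite (Real.exp (a + t * m))
  rw [integral_exp_realDegree] at h1
  have hset : {G : SimpleGraph (Fin n) | a ≤ t * (realDegree G i - m)} =
      {G | Real.exp (a + t * m) ≤ Real.exp (t * realDegree G i)} := by
    ext G
    simp only [Set.mem_ofPred_eq, Real.exp_le_exp]
    constructor <;> intro h <;> linarith
  rw [hset]
  -- Uses e^t ≤ 1 + t + t² for |t| ≤ 1, then 1 + x ≤ e^x.
  have h2 : (1 + (p : ℝ) * (Real.exp t - 1)) ^ (n - 1) ≤ Real.exp (m * (t + t ^ 2)) := by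
    have hbase : 0 ≤ 1 + (p : ℝ) * (Real.exp t - 1) := by
      have := p.2.1
      have := p.2.2
      nlinarith [Real.exp_pos t]
    have h3 : Real.exp t - 1 ≤ t + t ^ 2 := by
      have := (abs_le.1 (Real.abs_exp_sub_one_sub_id_le ht)).2
      linarith
    have h4 : 1 + (p : ℝ) * (Real.exp t - 1) ≤ Real.exp ((p : ℝ) * (t + t ^ 2)) := by
      have := Real.add_one_le_exp ((p : ℝ) * (t + t ^ 2))
      have := mul_le_mul_of_nonneg_left h3 p.2.1
      linarith
    calc _ ≤ Real.exp ((p : ℝ) * (t + t ^ 2)) ^ (n - 1) := by gcongr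
      _ = _ := by
        rw [← Real.exp_nat_mul, hn, hm]
        ring_nf
  have h5 : Real.exp (a + t * m) * (SimpleGraph.binomialRandom (Fin n) p).real
      {G | Real.exp (a + t * m) ≤ Real.exp (t * realDegree G i)} ≤
      Real.exp (a + t * m) * Real.exp (-a + t ^ 2 * m) := by
    rw [← Real.exp_add]
    refine (h1.trans h2).trans (le_of_eq ?_)
    ring_nf
  exact le_of_mul_le_mul_left h5 (Real.exp_pos _)

/-- All degrees concentrate around `(n - 1) p`. -/
lemma measureReal_exists_realDegree_le (n : ℕ) (p : unitInterval) {δ : ℝ} (hδ : 0 < δ)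
    (hδ1 : δ ≤ 1) :
    (SimpleGraph.binomialRandom (Fin n) p).real
      {G | ∃ i, δ * (((n : ℝ) - 1) * p) < |realDegree G i - ((n : ℝ) - 1) * p|} ≤
      n * (2 * Real.exp (-(δ ^ 2 / 4) * (((n : ℝ) - 1) * p))) := by
  set m := ((n : ℝ) - 1) * (p : ℝ) with hm
  set μ := SimpleGraph.binomialRandom (Fin n) p
  -- The slopes t = ±δ/2 handle the two tails; δ/2 minimizes -tδm + t²m, giving -δ²m/4.
  have hsub : {G : SimpleGraph (Fin n) | ∃ i, δ * m < |realDegree G i - m|} ⊆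
      ⋃ i, ({G | δ / 2 * (δ * m) ≤ (δ / 2) * (realDegree G i - m)} ∪
        {G | δ / 2 * (δ * m) ≤ (-(δ / 2)) * (realDegree G i - m)}) := by
    rintro G ⟨i, hi⟩
    refine Set.mem_iUnion.2 ⟨i, ?_⟩
    rcases lt_abs.1 hi with h | h
    · left
      exact mul_le_mul_of_nonneg_left h.le (by positivity)
    · right
      change δ / 2 * (δ * m) ≤ (-(δ / 2)) * (realDegree G i - m)
      have := mul_le_mul_of_nonneg_left h.le (show 0 ≤ δ / 2 by positivity)
      linarith
  refine (measureReal_mono hsub).trans ((measureReal_iUnion_fintype_le _).trans ?_)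
  have hi : ∀ i : Fin n, μ.real ({G | δ / 2 * (δ * m) ≤ (δ / 2) * (realDegree G i - m)} ∪
      {G | δ / 2 * (δ * m) ≤ (-(δ / 2)) * (realDegree G i - m)}) ≤
      2 * Real.exp (-(δ ^ 2 / 4) * m) := by
    intro i
    have h1 := measureReal_realDegree_le p i (t := δ / 2) (a := δ / 2 * (δ * m))
      (by rw [abs_of_pos (by positivity)]; linarith)
    have h2 := measureReal_realDegree_le p i (t := -(δ / 2)) (a := δ / 2 * (δ * m))
      (by rw [abs_neg, abs_of_pos (by positivity)]; linarith)
    rw [← hm] at h1 h2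
    have e1 : -(δ / 2 * (δ * m)) + (δ / 2) ^ 2 * m = -(δ ^ 2 / 4) * m := by ring
    have e2 : -(δ / 2 * (δ * m)) + (-(δ / 2)) ^ 2 * m = -(δ ^ 2 / 4) * m := by ring
    rw [e1] at h1
    rw [e2] at h2
    refine (measureReal_union_le _ _).trans ?_
    linarith
  refine (Finset.sum_le_sum fun i _ => hi i).trans ?_
  simp

end RandomGraph

/-! ### Reduction to `companion` -/

lemma integral_esm {κ : Type*} [Fintype κ] [DecidableEq κ] (M : Matrix κ κ ℂ) (f : ℂ →ᵇ ℝ) :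
    ∫ z, f z ∂(esm M) = (M.charpoly.roots.map f).sum / Fintype.card κ := by
  have key : ∀ S : Multiset ℂ, IsFiniteMeasure (S.map Measure.dirac).sum ∧
      ∫ z, f z ∂(S.map Measure.dirac).sum = (S.map f).sum := by
    intro S
    induction S using Multiset.induction with
    | empty =>
      simp only [Multiset.map_zero, Multiset.sum_zero, integral_zero_measure, and_true]
      infer_instance
    | cons a S ih =>
      have := ih.1
      simp only [Multiset.map_cons, Multiset.sum_cons]
      refine ⟨inferInstance, ?_⟩
      rw [integral_add_measure (f.integrable _) (f.integrable _), ih.2, integral_dirac]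
  rw [esm, integral_smul_measure, (key _).2]
  simp [div_eq_inv_mul]

/-- The two matrices are XY and YX with Y = diag(1, s), so s may even vanish. -/
lemma charpoly_fromBlocks_smul {ι : Type*} [Fintype ι] [DecidableEq ι] (A B C : Matrix ι ι ℂ)
    (s : ℂ) :
    (Matrix.fromBlocks A (s • B) C 0).charpoly = (Matrix.fromBlocks A B (s • C) 0).charpoly := by
  have h1 : Matrix.fromBlocks A (s • B) C 0 =
      Matrix.fromBlocks A B C 0 * Matrix.fromBlocks 1 0 0 (s • (1 : Matrix ι ι ℂ)) := by
    simp [Matrix.fromBlocks_multiply]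
  have h2 : Matrix.fromBlocks A B (s • C) 0 =
      Matrix.fromBlocks 1 0 0 (s • (1 : Matrix ι ι ℂ)) * Matrix.fromBlocks A B C 0 := by
    simp [Matrix.fromBlocks_multiply]
  rw [h1, h2, Matrix.charpoly_mul_comm]

section Graph

variable {n : ℕ}

lemma sum_adj (G : SimpleGraph (Fin n)) (i : Fin n) :
    ∑ j, adj G i j = ((realDegree G i : ℝ) : ℂ) := by
  classical
  rw [realDegree, Complex.ofReal_sum]
  refine Finset.sum_congr rfl fun j _ => ?_
  by_cases h : G.Adj i j <;> simp [adj, SimpleGraph.adjMatrix_apply, h]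

/-- The rescaled adjacency matrix. -/
noncomputable def scaledAdj (p : unitInterval) (G : SimpleGraph (Fin n)) :
    Matrix (Fin n) (Fin n) ℂ :=
  ((1 / √(alpha n p) : ℝ) : ℂ) • adj G

lemma isHermitian_scaledAdj (p : unitInterval) (G : SimpleGraph (Fin n)) :
    (scaledAdj p G).IsHermitian := by
  classical
  ext i j
  by_cases h : G.Adj i j <;>
    simp [scaledAdj, adj, SimpleGraph.adjMatrix_apply, h, G.adj_comm j i]

lemma trace_scaledAdj_mul_self (p : unitInterval) (G : SimpleGraph (Fin n))
    (hα : 0 < alpha n p) :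
    (scaledAdj p G * scaledAdj p G).trace.re = ∑ i, realDegree G i / alpha n p := by
  classical
  have h1 : (scaledAdj p G * scaledAdj p G).trace =
      ∑ i, ((realDegree G i / alpha n p : ℝ) : ℂ) := by
    rw [Matrix.trace]
    refine Finset.sum_congr rfl fun i _ => ?_
    rw [Matrix.diag_apply, Matrix.mul_apply, Complex.ofReal_div, ← sum_adj, Finset.sum_div]
    refine Finset.sum_congr rfl fun j _ => ?_
    have hs : ((√(alpha n p) : ℝ) : ℂ) * ((√(alpha n p) : ℝ) : ℂ) = (alpha n p : ℂ) := by
      rw [← Complex.ofReal_mul, Real.mul_self_sqrt hα.le]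
    by_cases h : G.Adj i j
    · simp [scaledAdj, adj, SimpleGraph.adjMatrix_apply, h, h.symm, ← hs]
    · simp [scaledAdj, adj, SimpleGraph.adjMatrix_apply, h]
  rw [h1, ← Complex.ofReal_sum, Complex.ofReal_re]

/-- Division by √α leaves factors √α and 1/√α in the off-diagonal blocks; moving the first across to
the second block cancels them. -/
lemma charpoly_rescale_fromBlocks (p : unitInterval) (hα : 0 < alpha n p)
    (G : SimpleGraph (Fin n)) (d : Fin n → ℂ) :
    (rescale p (Matrix.fromBlocks (adj G)
      (-((alpha n p : ℂ) • (1 + Matrix.diagonal d))) 1 0)).charpoly =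
      (companion (scaledAdj p G) d).charpoly := by
  set s : ℂ := ((√(alpha n p) : ℝ) : ℂ) with hs
  have hs0 : s ≠ 0 := by
    rw [hs]
    exact_mod_cast (Real.sqrt_pos.2 hα).ne'
  have hss : (alpha n p : ℂ) = s * s := by
    rw [hs, ← Complex.ofReal_mul, Real.mul_self_sqrt hα.le]
  have hc : ((1 / √(alpha n p) : ℝ) : ℂ) = s⁻¹ := by simp [hs]
  have h1 : rescale p (Matrix.fromBlocks (adj G)
      (-((alpha n p : ℂ) • (1 + Matrix.diagonal d))) 1 0) =
      Matrix.fromBlocks (scaledAdj p G) (s • (-(1 + Matrix.diagonal d))) (s⁻¹ • 1) 0 := by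
    rw [rescale, scaledAdj, hc, hss, Matrix.fromBlocks_smul]
    congr 1
    · rw [smul_neg, smul_neg, smul_smul, ← mul_assoc, inv_mul_cancel₀ hs0, one_mul]
    · simp
  rw [h1, charpoly_fromBlocks_smul, smul_smul, mul_inv_cancel₀ hs0, one_smul]
  rfl

/-- Since α + 1 = (n-1)p, one has 1 - deg i = -α(1 + d i) with d i the relative deviation of the
degree. -/
lemma charpoly_rescale_opH (p : unitInterval) (hα : 0 < alpha n p) (G : SimpleGraph (Fin n)) :
    (rescale p (opH G)).charpoly = (companion (scaledAdj p G) fun i =>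
      (((realDegree G i - ((n : ℝ) - 1) * p) / alpha n p : ℝ) : ℂ)).charpoly := by
  rw [← charpoly_rescale_fromBlocks p hα G, opH]
  congr 3
  have hα' : (alpha n p : ℂ) ≠ 0 := by exact_mod_cast hα.ne'
  ext i j
  by_cases hij : i = j
  · subst hij
    simp only [degMatrix, Matrix.sub_apply, Matrix.one_apply_eq, Matrix.diagonal_apply_eq, sum_adj,
      Matrix.neg_apply, Matrix.smul_apply, Matrix.add_apply, smul_eq_mul]
    push_cast
    rw [mul_add, mul_div_cancel₀ _ hα']
    simp only [alpha]
    push_cast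
    ring
  · simp [degMatrix, hij]

lemma charpoly_rescale_opH₀ (p : unitInterval) (hα : 0 < alpha n p) (G : SimpleGraph (Fin n)) :
    (rescale p (opH₀ p G)).charpoly = (companion (scaledAdj p G) 0).charpoly := by
  rw [← charpoly_rescale_fromBlocks p hα G, opH₀, expDegMatrix_eq]
  congr 3
  ext i j
  by_cases hij : i = j
  · subst hij
    simp [alpha]
  · simp [hij]

end Graph

/-- If all degrees are close to `(n - 1) p`, then the empirical spectral measures are close. -/
theorem exists_forall_abs_integral_esm_le (f : ℂ →ᵇ ℝ) {ε : ℝ} (hε : 0 < ε) :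
    ∃ δ, 0 < δ ∧ δ ≤ 1 ∧ ∀ (n : ℕ) (p : unitInterval) (G : SimpleGraph (Fin n)),
      2 ≤ ((n : ℝ) - 1) * p →
      (∀ i, |realDegree G i - ((n : ℝ) - 1) * p| ≤ δ * (((n : ℝ) - 1) * p)) →
      |∫ z, f z ∂(esm (rescale p (opH G))) - ∫ z, f z ∂(esm (rescale p (opH₀ p G)))| ≤ ε := by
  obtain ⟨δ, hδ, h⟩ := exists_forall_abs_sum_companion_le f hε
  -- From m ≥ 2 follows α = m - 1 ≥ m/2. Then δ/2 bounds the deviation by δα, and 1 bounds the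
  -- degrees by 2m ≤ 4α, which controls the trace.
  refine ⟨min 1 (δ / 2), by positivity, min_le_left _ _, fun n p G hm hG => ?_⟩
  set m := ((n : ℝ) - 1) * (p : ℝ) with hmdef
  have hαm : alpha n p = m - 1 := rfl
  have hα : 0 < alpha n p := by rw [hαm]; linarith
  have hα2 : m / 2 ≤ alpha n p := by rw [hαm]; linarith
  have hd : ∀ i, ‖(((realDegree G i - m) / alpha n p : ℝ) : ℂ)‖ ≤ δ := by
    intro i
    rw [Complex.norm_real, Real.norm_eq_abs, abs_div, abs_of_pos hα, div_le_iff₀ hα]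
    calc |realDegree G i - m| ≤ min 1 (δ / 2) * m := hG i
      _ ≤ δ / 2 * m := by gcongr; exact min_le_right _ _
      _ = δ * (m / 2) := by ring
      _ ≤ δ * alpha n p := by gcongr
  have htr : (scaledAdj p G * scaledAdj p G).trace.re ≤ 4 * n := by
    rw [trace_scaledAdj_mul_self p G hα]
    have hi : ∀ i : Fin n, realDegree G i / alpha n p ≤ 4 := by
      intro i
      rw [div_le_iff₀ hα]
      have h1 := (abs_le.1 (hG i)).2
      have h2 : min 1 (δ / 2) * m ≤ 1 * m := by gcongr; exact min_le_left _ _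
      linarith
    refine (Finset.sum_le_sum fun i _ => hi i).trans (le_of_eq ?_)
    simp [mul_comm]
  have h1 := h n (scaledAdj p G) (isHermitian_scaledAdj p G) htr _ hd
  rw [integral_esm, integral_esm, charpoly_rescale_opH p hα, charpoly_rescale_opH₀ p hα,
    ← sub_div, abs_div, Nat.abs_cast]
  exact div_le_of_le_mul₀ (Nat.cast_nonneg _) hε.le h1

/-! ### Almost sure control of the degrees -/

section Growth

variable {p : ℕ → unitInterval}

lemma eventually_le_expected_degree
    (hp : Tendsto (fun n : ℕ => (n : ℝ) * (p n : ℝ) / Real.log (n : ℝ)) atTop atTop) (K : ℝ) :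
    ∀ᶠ n : ℕ in atTop, K * Real.log n ≤ ((n : ℝ) - 1) * p n := by
  -- The factor 2 pays for replacing n by n - 1 ≥ n/2.
  filter_upwards [hp.eventually_ge_atTop (2 * K), eventually_ge_atTop 2] with n hn hn2
  have hn2' : (2 : ℝ) ≤ n := by exact_mod_cast hn2
  have hlog : 0 < Real.log n := Real.log_pos (by linarith)
  rw [le_div_iff₀ hlog] at hn
  have := (p n).2.1
  nlinarith

lemma tendsto_expected_degree
    (hp : Tendsto (fun n : ℕ => (n : ℝ) * (p n : ℝ) / Real.log (n : ℝ)) atTop atTop) :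
    Tendsto (fun n : ℕ => ((n : ℝ) - 1) * p n) atTop atTop :=
  tendsto_atTop_mono' _ (eventually_le_expected_degree hp 1)
    (by simpa [Function.comp_def] using Real.tendsto_log_atTop.comp tendsto_natCast_atTop_atTop)

/-- The probability that some degree is far from its mean is summable. -/
lemma eventually_measureReal_degree_le
    (hp : Tendsto (fun n : ℕ => (n : ℝ) * (p n : ℝ) / Real.log (n : ℝ)) atTop atTop)
    {δ : ℝ} (hδ : 0 < δ) (hδ1 : δ ≤ 1) :
    ∀ᶠ n : ℕ in atTop, (SimpleGraph.binomialRandom (Fin n) (p n)).real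
      {G | ∃ i, δ * (((n : ℝ) - 1) * p n) < |realDegree G i - ((n : ℝ) - 1) * p n|} ≤
      2 * ((n : ℝ) ^ 2)⁻¹ := by
  -- 12/δ² makes the Chernoff exponent at least 3 log n; the union over n vertices leaves n⁻², which
  -- is summable.
  filter_upwards [eventually_le_expected_degree hp (12 / δ ^ 2), eventually_ge_atTop 1]
    with n hn hn1
  refine (measureReal_exists_realDegree_le n (p n) hδ hδ1).trans ?_
  have hn0 : (0 : ℝ) < n := by exact_mod_cast hn1
  have h1 : Real.exp (-(δ ^ 2 / 4) * (((n : ℝ) - 1) * p n)) ≤ ((n : ℝ) ^ 3)⁻¹ := by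
    rw [← Real.exp_log (show 0 < ((n : ℝ) ^ 3)⁻¹ by positivity), Real.exp_le_exp, Real.log_inv,
      Real.log_pow]
    have h2 := mul_le_mul_of_nonneg_left hn (show 0 ≤ δ ^ 2 / 4 by positivity)
    have h3 : δ ^ 2 / 4 * (12 / δ ^ 2 * Real.log n) = 3 * Real.log n := by field_simp; ring
    push_cast
    linarith
  calc (n : ℝ) * (2 * Real.exp (-(δ ^ 2 / 4) * (((n : ℝ) - 1) * p n)))
      ≤ n * (2 * ((n : ℝ) ^ 3)⁻¹) := by gcongr
    _ = _ := by field_simp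

variable {Ω : Type*} [MeasurableSpace Ω] {P : Measure Ω} [IsProbabilityMeasure P]
  {G : (n : ℕ) → Ω → SimpleGraph (Fin n)}

/-- For every tolerance, the probabilities that the empirical integrals differ by more than the
tolerance are bounded by a summable sequence. -/
lemma eventually_measureReal_integral_esm_le
    (hp : Tendsto (fun n : ℕ => (n : ℝ) * (p n : ℝ) / Real.log (n : ℝ)) atTop atTop)
    (hG : ∀ n, HasLaw (G n) (SimpleGraph.binomialRandom (Fin n) (p n)) P)
    (f : ℂ →ᵇ ℝ) {ε : ℝ} (hε : 0 < ε) :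
    ∀ᶠ n : ℕ in atTop, P.real {ω | ε < |∫ z, f z ∂(esm (rescale (p n) (opH (G n ω)))) -
      ∫ z, f z ∂(esm (rescale (p n) (opH₀ (p n) (G n ω))))|} ≤ 2 * ((n : ℝ) ^ 2)⁻¹ := by
  obtain ⟨δ, hδ, hδ1, h⟩ := exists_forall_abs_integral_esm_le f hε
  filter_upwards [eventually_measureReal_degree_le hp hδ hδ1,
    (tendsto_expected_degree hp).eventually_ge_atTop 2] with n hn hm
  refine le_trans ?_ hn
  rw [← (hG n).measureReal_eq (Set.toFinite _).measurableSet]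
  refine measureReal_mono fun ω hω => ?_
  by_contra hcon
  refine absurd (h n (p n) (G n ω) hm fun i => ?_) (not_le.2 hω)
  by_contra hi
  exact hcon ⟨i, not_le.1 hi⟩

end Growth

end NonBacktracking

/-! ### Borel–Cantelli and the two modes of convergence -/

theorem theorem1p2 {Ω : Type*} [MeasurableSpace Ω] (P : Measure Ω) [IsProbabilityMeasure P]
    (p₀ : ℝ) (hp₀ : p₀ < 1) (p : ℕ → unitInterval)
    (hp_pos : ∀ n, 0 < (p n : ℝ)) (hp_le : ∀ n, (p n : ℝ) ≤ p₀)
    (hp_growth : Tendsto (fun n : ℕ => (n : ℝ) * (p n : ℝ) / Real.log (n : ℝ)) atTop atTop)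
    (G : (n : ℕ) → Ω → SimpleGraph (Fin n))
    (hG : ∀ n, HasLaw (G n) (SimpleGraph.binomialRandom (Fin n) (p n)) P) :
    NonBacktracking.DiffTendstoZeroAS P
      (fun n ω => NonBacktracking.esm
        (NonBacktracking.rescale (p n) (NonBacktracking.opH (G n ω))))
      (fun n ω => NonBacktracking.esm
        (NonBacktracking.rescale (p n) (NonBacktracking.opH₀ (p n) (G n ω)))) ∧
    NonBacktracking.DiffTendstoZeroInProb P
      (fun n ω => NonBacktracking.esm
        (NonBacktracking.rescale (p n) (NonBacktracking.opH (G n ω))))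
      (fun n ω => NonBacktracking.esm
        (NonBacktracking.rescale (p n) (NonBacktracking.opH₀ (p n) (G n ω)))) := by
  have hsummable : Summable fun n : ℕ => 2 * ((n : ℝ) ^ 2)⁻¹ :=
    (Real.summable_nat_pow_inv.2 one_lt_two).mul_left 2
  constructor
  · intro f
    have key : ∀ k : ℕ, ∀ᵐ ω ∂P, ∀ᶠ n : ℕ in atTop,
        |∫ z, f z ∂(NonBacktracking.esm (NonBacktracking.rescale (p n)
          (NonBacktracking.opH (G n ω)))) - ∫ z, f z ∂(NonBacktracking.esm
          (NonBacktracking.rescale (p n) (NonBacktracking.opH₀ (p n) (G n ω))))| ≤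
          1 / ((k : ℝ) + 1) := by
      intro k
      have h := NonBacktracking.eventually_measureReal_integral_esm_le hp_growth hG f
        (show (0 : ℝ) < 1 / ((k : ℝ) + 1) by positivity)
      have hs : Summable fun n : ℕ => P.real {ω | 1 / ((k : ℝ) + 1) <
          |∫ z, f z ∂(NonBacktracking.esm (NonBacktracking.rescale (p n)
          (NonBacktracking.opH (G n ω)))) - ∫ z, f z ∂(NonBacktracking.esm
          (NonBacktracking.rescale (p n) (NonBacktracking.opH₀ (p n) (G n ω))))|} := by
        refine hsummable.of_norm_bounded_eventually_nat ?_
        filter_upwards [h] with n hn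
        rwa [Real.norm_of_nonneg measureReal_nonneg]
      have hfin := hs.tsum_ofReal_ne_top
      simp only [Measure.real, ENNReal.ofReal_toReal (measure_ne_top P _)] at hfin
      -- This half of Borel–Cantelli needs only summability, so the joint law for different n plays
      -- no role.
      filter_upwards [ae_eventually_notMem hfin] with ω hω
      filter_upwards [hω] with n hn
      exact not_lt.1 hn
    -- Countably many tolerances 1/(k+1) yield a single almost sure event.
    filter_upwards [ae_all_iff.2 key] with ω hω
    rw [Metric.tendsto_nhds]
    intro ε hε
    obtain ⟨k, hk⟩ := exists_nat_one_div_lt hε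
    filter_upwards [hω k] with n hn
    rw [Real.dist_eq, sub_zero, abs_abs]
    exact hn.trans_lt hk
  · intro f ε hε
    have h := NonBacktracking.eventually_measureReal_integral_esm_le hp_growth hG f hε
    have h0 := squeeze_zero' (Eventually.of_forall fun n => measureReal_nonneg) h
      hsummable.tendsto_atTop_zero
    have h1 := ENNReal.tendsto_ofReal h0
    simpa only [Measure.real, ENNReal.ofReal_toReal (measure_ne_top P _), ENNReal.ofReal_zero] using h1
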